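/- **Setting.** Let $\Pi$ be a quantifier prefix with pairwise distinct variables, and let $u_1,\dots,u_n$ be its universal variables from left to right ($\Pi$ may already contain extension variables, which are quantified existentially). A *policy* $S$ over $\Pi$ (a partial strategy for the universal player) is given by variables $\mathrm{set}_S^i,\mathrm{val}_S^i$ ($1\le i\le n$) of $\Pi$ that are quantified left of $u_i$: $\mathrm{set}_S^i$ says that $S$ gives a value to $u_i$, and $\mathrm{val}_S^i$ is that value. We also write $S$ for the formula $\bigwedge_{i=1}^n\bigl(\mathrm{set}_S^i\to(u_i\leftrightarrow \mathrm{val}_S^i)\bigr)$. An *annotated literal* $l^\tau$ consists of a literal $l$ of an existential variable $x$ of $\Pi$ and a partial $\{0,1\}$-assignment $\tau$ to universal variables left of $x$; an *annotated clause* is a finite disjunction of annotated literals. Put $$\mathrm{ann}_{x,S}(\tau)=\bigwedge_{1/u_i\in\tau}(\mathrm{set}_S^i\wedge u_i)\wedge\bigwedge_{0/u_i\in\tau}(\mathrm{set}_S^i\wedge\neg u_i)\wedge\bigwedge_{u_i<_\Pi x,\ u_i\notin\mathrm{dom}(\tau)}\neg\mathrm{set}_S^i ,$$ $\mathrm{con}_S(l^\tau)=l\wedge\mathrm{ann}_{x,S}(\tau)$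 for a literal $l$ of $x$, and $\mathrm{con}_S(C)=\bigvee_{l^\tau\in C}\mathrm{con}_S(l^\tau)$. A *Frege system* is a finite set of sound schematic inference rules for propositional formulas that is implicationally complete. An *extended Frege (eFrege) derivation over $\Pi$* may use, besides premises and rule instances, lines $v\leftrightarrow A$ introducing a new variable $v$ not in the current prefix (hence in no premise, no earlier line and not in $A$); $v$ is inserted existentially into the prefix, right of all variables of $A$. All lines are formulas in the variables of the current prefix. Size is the number of symbols. **Lemma.** For every Frege system there is a polynomial $p$ such that the following holds for every prefix $\Pi$. Let $L$ and $R$ be policies over $\Pi$, let $C_1,C_2$ be annotated clauses, let $x$ be an existential variable of $\Pi$, and let $\tau$ be a partial $\{0,1\}$-assignment to universal variables left of $x$. Let $N$ be the total size of the two formulas $$L\to\mathrm{con}_L(C_1\vee\neg x^\tau),\qquad R\to\mathrm{con}_R(C_2\vee x^\tau).$$ Then there are an eFrege derivation of size at most $p(N)$ from these two formulas as premises, which starts with the prefix $\Pi$ and enlarges it by its extension variables to a prefix $\Pi'$, and a policy $B$ over $\Pi'$ (so that $\mathrm{set}_B^i$ and $\mathrm{val}_B^i$ are quantified left of $u_i$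 in $\Pi'$ for every $i$), such that the last line of the derivation is $$B\to\mathrm{con}_B(C_1\vee C_2).$$ -/

import Mathlib

namespace QBFPolicy

/-! ### Propositional formulas -/

/-- Propositional formulas over the variables `0, 1, 2, …`. -/
inductive Form where
  | var (v : ℕ) : Form
  | fls : Form
  | tru : Form
  | neg (A : Form) : Form
  | and (A B : Form) : Form
  | or (A B : Form) : Form
  | imp (A B : Form) : Form
  | iff (A B : Form) : Form

namespace Form

/-- Truth of a formula under an assignment of its variables. -/
def eval (v : ℕ → Prop) : Form → Prop
  | var x => v x
  | fls => False
  | tru => True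
  | neg A => ¬ A.eval v
  | and A B => A.eval v ∧ B.eval v
  | or A B => A.eval v ∨ B.eval v
  | imp A B => A.eval v → B.eval v
  | iff A B => (A.eval v ↔ B.eval v)

/-- The variables that occur in a formula. -/
def vars : Form → Finset ℕ
  | var x => {x}
  | fls => ∅
  | tru => ∅
  | neg A => A.vars
  | and A B => A.vars ∪ B.vars
  | or A B => A.vars ∪ B.vars
  | imp A B => A.vars ∪ B.vars
  | iff A B => A.vars ∪ B.vars

/-- Simultaneous substitution of formulas for variables. -/
def subst (s : ℕ → Form) : Form → Form
  | var x => s x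
  | fls => fls
  | tru => tru
  | neg A => neg (A.subst s)
  | and A B => and (A.subst s) (B.subst s)
  | or A B => or (A.subst s) (B.subst s)
  | imp A B => imp (A.subst s) (B.subst s)
  | iff A B => iff (A.subst s) (B.subst s)

/-- The size of a formula: its number of symbols (variables, constants and connectives). -/
def size : Form → ℕ
  | var _ => 1
  | fls => 1
  | tru => 1
  | neg A => A.size + 1
  | and A B => A.size + B.size + 1
  | or A B => A.size + B.size + 1
  | imp A B => A.size + B.size + 1
  | iff A B => A.size + B.size + 1

/-- The conjunction of a list of formulas; the empty conjunction is true. -/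
def bigAnd : List Form → Form
  | [] => tru
  | A :: l => and A (bigAnd l)

/-- The disjunction of a list of formulas; the empty disjunction is false. -/
def bigOr : List Form → Form
  | [] => fls
  | A :: l => or A (bigOr l)

end Form

/-! ### Frege systems -/

/-- A schematic inference rule: from the premises infer the conclusion, where any formulas may
be substituted for the variables. A rule without premises is an axiom scheme. -/
structure FregeRule where
  prems : List Form
  concl : Form

/-- The formulas that can be derived from `Γ` by instances of the given rules. -/
inductive FregeDerivable (rules : List FregeRule) (Γ : List Form) : Form → Prop
  | hyp {A : Form} (h : A ∈ Γ) : FregeDerivable rules Γ A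
  | rule {r : FregeRule} (hr : r ∈ rules) (s : ℕ → Form)
      (h : ∀ A ∈ r.prems, FregeDerivable rules Γ (A.subst s)) :
      FregeDerivable rules Γ (r.concl.subst s)

/-- A Frege system: finitely many schematic rules which are sound and (implicationally)
complete. -/
structure FregeSystem where
  rules : List FregeRule
  sound : ∀ r ∈ rules, ∀ v : ℕ → Prop, (∀ A ∈ r.prems, A.eval v) → r.concl.eval v
  complete : ∀ (Γ : List Form) (A : Form),
    (∀ v : ℕ → Prop, (∀ G ∈ Γ, G.eval v) → A.eval v) → FregeDerivable rules Γ A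

/-- `A` follows from some of the earlier `lines` by one instance of one rule of `F`. -/
def FregeSystem.Infers (F : FregeSystem) (lines : List Form) (A : Form) : Prop :=
  ∃ r ∈ F.rules, ∃ s : ℕ → Form, (∀ G ∈ r.prems, G.subst s ∈ lines) ∧ A = r.concl.subst s

namespace FregeSystem

/-! ### Frege systems exist -/

open Form

/-- A list of sound rules, with which truth tables can be evaluated under an assumption `var 0`. -/
def tableRules : List FregeRule :=
  let g := var 0
  let p := var 1
  let q := var 2
  [⟨[], imp g tru⟩, ⟨[], imp g (neg fls)⟩,
   ⟨[imp g p], imp g (neg (neg p))⟩,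
   ⟨[imp g p, imp g q], imp g (and p q)⟩,
   ⟨[imp g (neg p)], imp g (neg (and p q))⟩,
   ⟨[imp g (neg q)], imp g (neg (and p q))⟩,
   ⟨[imp g p], imp g (or p q)⟩,
   ⟨[imp g q], imp g (or p q)⟩,
   ⟨[imp g (neg p), imp g (neg q)], imp g (neg (or p q))⟩,
   ⟨[imp g (neg p)], imp g (imp p q)⟩,
   ⟨[imp g q], imp g (imp p q)⟩,
   ⟨[imp g p, imp g (neg q)], imp g (neg (imp p q))⟩,
   ⟨[imp g p, imp g q], imp g (iff p q)⟩,
   ⟨[imp g (neg p), imp g (neg q)], imp g (iff p q)⟩,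
   ⟨[imp g p, imp g (neg q)], imp g (neg (iff p q))⟩,
   ⟨[imp g (neg p), imp g q], imp g (neg (iff p q))⟩,
   ⟨[], imp (and g p) p⟩,
   ⟨[imp g q], imp (and g p) q⟩,
   ⟨[imp (and g p) q, imp (and g (neg p)) q], imp g q⟩,
   ⟨[imp tru q], q⟩,
   ⟨[p, imp p q], q⟩]

theorem tableRules_sound : ∀ r ∈ tableRules, ∀ v : ℕ → Prop,
    (∀ A ∈ r.prems, A.eval v) → r.concl.eval v := by
  intro r hr v
  simp only [tableRules, List.mem_cons, List.not_mem_nil, or_false] at hr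
  rcases hr with h | h | h | h | h | h | h | h | h | h | h | h | h | h | h | h | h | h | h | h | h <;>
    subst h <;> simp [Form.eval] <;> tauto

/-- The substitution of three formulas for the variables `0`, `1`, `2`. -/
def subst₃ (g p q : Form) : ℕ → Form
  | 0 => g
  | 1 => p
  | _ => q

theorem tableRules_step {Γ : List Form} (i : Fin 21) (g p q : Form)
    (h : ((tableRules.get i).prems.map (Form.subst (subst₃ g p q))).Forall
      (FregeDerivable tableRules Γ)) :
    FregeDerivable tableRules Γ ((tableRules.get i).concl.subst (subst₃ g p q)) :=
  FregeDerivable.rule (List.get_mem _ _) _ fun _ hA =>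
    List.forall_iff_forall_mem.1 h _ (List.mem_map_of_mem hA)

open Classical in
theorem tableRules_eval {Γ : List Form} (g : Form) (v : ℕ → Prop) (A : Form)
    (hA : ∀ x ∈ A.vars, FregeDerivable tableRules Γ
      (imp g (if v x then var x else neg (var x)))) :
    FregeDerivable tableRules Γ (imp g (if A.eval v then A else neg A)) := by
  induction A with
  | var x => exact hA x (by simp [vars])
  | fls => rw [if_neg (show ¬ Form.eval v fls from id)]; exact tableRules_step 1 g g g trivial
  | tru => rw [if_pos (show Form.eval v tru from trivial)]; exact tableRules_step 0 g g g trivial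
  | neg A ih =>
    have h1 := ih hA
    by_cases a : A.eval v
    · simp only [a, if_true] at h1
      simp only [Form.eval, a, not_true, if_false]; exact tableRules_step 2 g A A h1
    · simpa [Form.eval, a] using h1
  | and A B ihA ihB =>
    have h1 := ihA fun x hx => hA x (by simp [vars, hx])
    have h2 := ihB fun x hx => hA x (by simp [vars, hx])
    by_cases a : A.eval v <;> by_cases b : B.eval v <;>
      simp only [a, b, if_true, if_false] at h1 h2 <;> simp [Form.eval, a, b]
    · exact tableRules_step 3 g A B ⟨h1, h2⟩
    · exact tableRules_step 5 g A B h2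
    · exact tableRules_step 4 g A B h1
    · exact tableRules_step 4 g A B h1
  | or A B ihA ihB =>
    have h1 := ihA fun x hx => hA x (by simp [vars, hx])
    have h2 := ihB fun x hx => hA x (by simp [vars, hx])
    by_cases a : A.eval v <;> by_cases b : B.eval v <;>
      simp only [a, b, if_true, if_false] at h1 h2 <;> simp [Form.eval, a, b]
    · exact tableRules_step 6 g A B h1
    · exact tableRules_step 6 g A B h1
    · exact tableRules_step 7 g A B h2
    · exact tableRules_step 8 g A B ⟨h1, h2⟩
  | imp A B ihA ihB =>
    have h1 := ihA fun x hx => hA x (by simp [vars, hx])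
    have h2 := ihB fun x hx => hA x (by simp [vars, hx])
    by_cases a : A.eval v <;> by_cases b : B.eval v <;>
      simp only [a, b, if_true, if_false] at h1 h2 <;> simp [Form.eval, a, b]
    · exact tableRules_step 10 g A B h2
    · exact tableRules_step 11 g A B ⟨h1, h2⟩
    · exact tableRules_step 9 g A B h1
    · exact tableRules_step 9 g A B h1
  | iff A B ihA ihB =>
    have h1 := ihA fun x hx => hA x (by simp [vars, hx])
    have h2 := ihB fun x hx => hA x (by simp [vars, hx])
    by_cases a : A.eval v <;> by_cases b : B.eval v <;>
      simp only [a, b, if_true, if_false] at h1 h2 <;> simp [Form.eval, a, b]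
    · exact tableRules_step 12 g A B ⟨h1, h2⟩
    · exact tableRules_step 14 g A B ⟨h1, h2⟩
    · exact tableRules_step 15 g A B ⟨h1, h2⟩
    · exact tableRules_step 13 g A B ⟨h1, h2⟩

open Classical in
theorem tableRules_taut {Γ : List Form} (A : Form) (hA : ∀ v, A.eval v) (ws : List ℕ) :
    ∀ (g : Form) (v : ℕ → Prop),
      (∀ x ∈ A.vars, x ∉ ws → FregeDerivable tableRules Γ
        (imp g (if v x then var x else neg (var x)))) →
      FregeDerivable tableRules Γ (imp g A) := by
  induction ws with
  | nil =>
    intro g v h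
    simpa [hA v] using tableRules_eval g v A fun x hx => h x hx (by simp)
  | cons w ws ih =>
    intro g v h
    have key : ∀ b : Prop, FregeDerivable tableRules Γ
        (imp (and g (if b then var w else neg (var w))) A) := by
      intro b
      refine ih _ (Function.update v w b) fun x hx hw => ?_
      by_cases e : x = w
      · subst e
        simp only [Function.update_self]
        exact tableRules_step 16 g (if b then var x else neg (var x)) g trivial
      · simp only [Function.update_of_ne e]
        exact tableRules_step 17 g (if b then var w else neg (var w))
          (if v x then var x else neg (var x)) (h x hx (by simp [e, hw]))
    have h1 := key True
    have h2 := key False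
    simp only [if_true, if_false] at h1 h2
    exact tableRules_step 18 g (var w) A ⟨h1, h2⟩

theorem tableRules_complete (Γ : List Form) (A : Form)
    (h : ∀ v : ℕ → Prop, (∀ G ∈ Γ, G.eval v) → A.eval v) : FregeDerivable tableRules Γ A := by
  have main : ∀ (Δ : List Form) (A : Form), (∀ G ∈ Δ, G ∈ Γ) →
      (∀ v : ℕ → Prop, (∀ G ∈ Δ, G.eval v) → A.eval v) → FregeDerivable tableRules Γ A := by
    intro Δ
    induction Δ with
    | nil =>
      intro A _ hA
      refine tableRules_step 19 A A A ?_
      exact tableRules_taut (Γ := Γ) A (fun v => hA v (by simp)) A.vars.toList tru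
        (fun _ => True) (by intro x hx hx'; simp [hx] at hx')
    | cons G Δ ih =>
      intro A hΔ hA
      have h1 := ih (imp G A) (fun H hH => hΔ H (by simp [hH])) (fun v hv hG => hA v (by
        intro H hH
        rcases List.mem_cons.1 hH with e | e
        · exact e ▸ hG
        · exact hv H e))
      exact tableRules_step 20 G G A ⟨FregeDerivable.hyp (hΔ G (by simp)), h1⟩
  exact main Γ A (fun _ h => h) h

instance : Nonempty FregeSystem := ⟨⟨tableRules, tableRules_sound, tableRules_complete⟩⟩

end FregeSystem

/-! ### Quantifier prefixes -/

inductive Quant where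
  | ex : Quant
  | all : Quant
deriving DecidableEq

/-- A quantifier prefix, from left to right. -/
abbrev QPrefix := List (Quant × ℕ)

/-- The variables of the prefix, from left to right. -/
def QPrefix.names (P : QPrefix) : List ℕ := P.map Prod.snd

/-- The universal variables `u₁, …, uₙ` of the prefix, from left to right. -/
def QPrefix.universals (P : QPrefix) : List ℕ :=
  (P.filter (fun q => q.1 = Quant.all)).map Prod.snd

/-- `v` stands left of `w` in the prefix. -/
def QPrefix.LeftOf (P : QPrefix) (v w : ℕ) : Prop :=
  ∃ l₁ l₂ : List ℕ, QPrefix.names P = l₁ ++ w :: l₂ ∧ v ∈ l₁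

/-! ### Extended Frege derivations over a prefix -/

/-- `EFregeDerivation F P₀ Γ P π`: the list of formulas `π` (the most recent line first) is an
extended Frege derivation from the premises `Γ`, which starts with the prefix `P₀` and in which
the introduction of extension variables enlarges the prefix to `P`.

All lines are formulas in the variables of the current prefix. An extension variable `v` is not
in the current prefix (so it is in no earlier line, in no premise and not in its definition `A`);
it is introduced by the line `v ↔ A` and quantified existentially at some place to the right of
all the variables of `A`. -/
inductive EFregeDerivation (F : FregeSystem) (P₀ : QPrefix) (Γ : List Form) :
    QPrefix → List Form → Prop
  | nil : EFregeDerivation F P₀ Γ P₀ []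
  | hyp {P : QPrefix} {π : List Form} {A : Form} (d : EFregeDerivation F P₀ Γ P π)
      (hA : A ∈ Γ) (hv : ∀ v ∈ A.vars, v ∈ QPrefix.names P₀) :
      EFregeDerivation F P₀ Γ P (A :: π)
  | rule {P : QPrefix} {π : List Form} {A : Form} (d : EFregeDerivation F P₀ Γ P π)
      (hA : F.Infers π A) (hv : ∀ v ∈ A.vars, v ∈ QPrefix.names P) :
      EFregeDerivation F P₀ Γ P (A :: π)
  | ext {P₁ P₂ : QPrefix} {π : List Form} {A : Form} {v : ℕ}
      (d : EFregeDerivation F P₀ Γ (P₁ ++ P₂) π)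
      (hnew : v ∉ QPrefix.names (P₁ ++ P₂)) (hv : ∀ w ∈ A.vars, w ∈ QPrefix.names P₁) :
      EFregeDerivation F P₀ Γ (P₁ ++ (Quant.ex, v) :: P₂) (Form.iff (Form.var v) A :: π)

/-- The size of a derivation: the number of symbols in all its lines. -/
def derivationSize (π : List Form) : ℕ := (π.map Form.size).sum

/-! ### Annotated clauses -/

/-- A partial assignment of truth values to variables; `τ u = some true` is written `1/u ∈ τ`
and `τ u = some false` is written `0/u ∈ τ`. -/
abbrev Annotation := ℕ → Option Bool

/-- The annotated literal `x^τ` (`pos = true`) or `(¬x)^τ` (`pos = false`). -/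
structure AnnLit where
  x : ℕ
  pos : Bool
  τ : Annotation

/-- The variable of the literal is existential, and its annotation assigns only universal
variables left of it. -/
def AnnLit.WellFormed (P : QPrefix) (l : AnnLit) : Prop :=
  (Quant.ex, l.x) ∈ P ∧
    ∀ u : ℕ, l.τ u ≠ none → u ∈ QPrefix.universals P ∧ QPrefix.LeftOf P u l.x

/-- An annotated clause, as a list of its literals. -/
abbrev AnnClause := List AnnLit

/-! ### Policies and the conversion of annotated clauses -/

/-- The variables by which a policy `S` is encoded: `setVar uᵢ` is the variable `set_S^i`
(the policy gives a value to `uᵢ`), `valVar uᵢ` is the variable `val_S^i` (that value). Only the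
values at universal variables matter. -/
structure Policy where
  setVar : ℕ → ℕ
  valVar : ℕ → ℕ

namespace Policy

/-- `S` is a policy over the prefix: for each universal variable `u`, both variables that
represent the partial function for `u` are quantified left of `u`. -/
def Respects (S : Policy) (P : QPrefix) : Prop :=
  ∀ u ∈ QPrefix.universals P,
    QPrefix.LeftOf P (S.setVar u) u ∧ QPrefix.LeftOf P (S.valVar u) u

/-- The formula `⋀ᵢ (set_S^i → (uᵢ ↔ val_S^i))`. -/
def toForm (P : QPrefix) (S : Policy) : Form :=
  Form.bigAnd ((QPrefix.universals P).map fun u =>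
    Form.imp (Form.var (S.setVar u)) (Form.iff (Form.var u) (Form.var (S.valVar u))))

open Classical in
/-- The conjuncts that the universal variable `u` contributes to `ann_{x,S}(τ)`. -/
noncomputable def annConj (P : QPrefix) (S : Policy) (x : ℕ) (τ : Annotation) (u : ℕ) :
    List Form :=
  match τ u with
  | some true => [Form.and (Form.var (S.setVar u)) (Form.var u)]
  | some false => [Form.and (Form.var (S.setVar u)) (Form.neg (Form.var u))]
  | none => if QPrefix.LeftOf P u x then [Form.neg (Form.var (S.setVar u))] else []

/-- The formula `ann_{x,S}(τ)`. -/
noncomputable def ann (P : QPrefix) (S : Policy) (x : ℕ) (τ : Annotation) : Form :=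
  Form.bigAnd ((QPrefix.universals P).flatMap (annConj P S x τ))

/-- The formula `con_S(l) = l ∧ ann_{x,S}(τ)` for an annotated literal with variable `x` and
annotation `τ`. -/
noncomputable def conLit (P : QPrefix) (S : Policy) (l : AnnLit) : Form :=
  Form.and (if l.pos then Form.var l.x else Form.neg (Form.var l.x)) (ann P S l.x l.τ)

/-- The formula `con_S(C) = ⋁_{l ∈ C} con_S(l)`. -/
noncomputable def con (P : QPrefix) (S : Policy) (C : AnnClause) : Form :=
  Form.bigOr (C.map (conLit P S))

/-- The formula `S → con_S(C)`. -/
noncomputable def claim (P : QPrefix) (S : Policy) (C : AnnClause) : Form :=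
  Form.imp (S.toForm P) (con P S C)

end Policy

end QBFPolicy

/-!
The policy `B` compares `L` and `R` with the annotation `τ`, from left to right along the universal
variables left of `x`. While both agree with `τ` they also agree with each other, and it does not
matter which one is followed. At the first variable where one of them differs from `τ`, the policy
`B` commits itself to such a policy, and it follows it from there on. If neither has differed when
`x` is reached, the value of `x` decides: `L` is followed if `x` is true, and `R` if `x` is false.

So `B` acts throughout like one of the two policies, which is told by one formula,
`Policy.choice` (`CostDerivability.select_of_choice`, `CostDerivability.not_select_of_not_choice`).
Suppose that this is `L`. Then either `L` differs from `τ`, so that `ann_{x,L}(τ)` fails while `L` is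
followed, or `x` is true; in both cases the literal `¬x^τ` is not the one that makes
`con_L(C₁ ∨ ¬x^τ)` true (`CostDerivability.not_conLit_of_choice`). Hence `con_L(C₁)` holds, and so
does `con_B(C₁)`, since the two formulas only look at what the policies do
(`CostDerivability.con_of_same`). The case of `R` is symmetric.

The state of the comparison after a variable is written out as a formula of quadratic size
(`Policy.differsFirst`, `Policy.agreeAll`) in variables left of that universal variable. Thus the
only extension variables are those of `B`, inserted immediately left of the universal variables
(`QPrefix.expand`, `EFregeDerivation.exists_expand`).

For the length of derivations, only finitely many schemes of bounded size are used. Each has a fixed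
derivation in the given Frege system by completeness, and its instances are derived in size linear
in that of the substituted formulas (`FregeDerivable.replay`). It then suffices to count steps, in
the notion of derivability `CostDerivability`, and to bound the size of the formulas involved.
-/

namespace QBFPolicy

/-! ### Substitution -/

namespace Form

theorem subst_subst (s t : ℕ → Form) (A : Form) :
    (A.subst s).subst t = A.subst fun v => (s v).subst t := by
  induction A <;> simp_all [subst]

theorem one_le_size (A : Form) : 1 ≤ A.size := by
  cases A <;> simp [size]

theorem size_subst_le {s : ℕ → Form} {M : ℕ} (hs : ∀ v, (s v).size ≤ M) (A : Form) :
    (A.subst s).size ≤ A.size * M := by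
  have hM : 1 ≤ M := (one_le_size _).trans (hs 0)
  induction A with
  | var v => simpa [subst, size] using hs v
  | fls | tru => simpa [subst, size] using hM
  | neg A ih => simp only [subst, size, add_mul, one_mul]; omega
  | and A B ihA ihB | or A B ihA ihB | imp A B ihA ihB | iff A B ihA ihB =>
    simp only [subst, size, add_mul, one_mul]; omega

theorem vars_subst {s : ℕ → Form} {p : ℕ → Prop} (hs : ∀ v, ∀ w ∈ (s v).vars, p w) (A : Form) :
    ∀ w ∈ (A.subst s).vars, p w := by
  induction A with
  | var v => exact hs v
  | fls | tru => simp [subst, vars]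
  | neg A ih => exact ih
  | and A B ihA ihB | or A B ihA ihB | imp A B ihA ihB | iff A B ihA ihB =>
    intro w hw
    rcases Finset.mem_union.1 hw with h | h
    exacts [ihA w h, ihB w h]

/-- The substitution of the formulas of a list for the variables `0`, `1`, `2`, …; the remaining
variables are replaced by the constant `tru`, so that they contribute no variables. -/
def inst (l : List Form) (n : ℕ) : Form := l.getD n tru

/-- At most `M` symbols, and all variables in `V`. -/
def Within (M : ℕ) (V : List ℕ) (A : Form) : Prop := A.size ≤ M ∧ ∀ v ∈ A.vars, v ∈ V

theorem within_inst {M : ℕ} {V : List ℕ} (hM : 1 ≤ M) {l : List Form}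
    (h : ∀ A ∈ l, A.Within M V) (n : ℕ) : (inst l n).Within M V := by
  unfold inst
  rw [List.getD_eq_getElem?_getD]
  rcases hn : l[n]? with _ | A
  · simp [Within, size, vars, hM]
  · exact h A (List.mem_of_getElem? hn)

/-- The formulas that are used as schemes: few symbols, and few variables. -/
def Small (A : Form) : Prop := A.size ≤ 60 ∧ A.vars ⊆ Finset.range 20

instance : DecidablePred Small := fun _ => inferInstanceAs (Decidable (_ ∧ _))

theorem finite_size_le (n m : ℕ) :
    {A : Form | A.size ≤ n ∧ A.vars ⊆ Finset.range m}.Finite := by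
  induction n with
  | zero =>
    refine Set.finite_empty.subset fun A hA => ?_
    have := one_le_size A
    have := hA.1
    omega
  | succ n ih =>
    have fin2 (f : Form → Form → Form) := Set.Finite.image2 f ih ih
    refine (((((Set.toFinite {fls, tru}).union ((Finset.range m).finite_toSet.image var)).union
      (ih.image neg)).union ((fin2 and).union (fin2 or))).union
        ((fin2 imp).union (fin2 iff))).subset ?_
    intro A hA
    simp only [Set.mem_ofPred_eq] at hA
    cases A with
    | var v => simp_all [vars]
    | fls | tru => simp
    | neg A => simp_all [size, vars]
    | and A B | or A B | imp A B | iff A B =>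
      obtain ⟨h1, h2⟩ := hA
      simp only [size, vars, Finset.union_subset_iff] at h1 h2
      have hA : A ∈ {A : Form | A.size ≤ n ∧ A.vars ⊆ Finset.range m} := ⟨by omega, h2.1⟩
      have hB : B ∈ {A : Form | A.size ≤ n ∧ A.vars ⊆ Finset.range m} := ⟨by omega, h2.2⟩
      have key (f : Form → Form → Form) := Set.mem_image2_of_mem (f := f) hA hB
      simp only [Set.mem_union]
      tauto

end Form

theorem finite_lists_length_le {α : Type*} {S : Set α} (hS : S.Finite) (n : ℕ) :
    {l : List α | l.length ≤ n ∧ ∀ a ∈ l, a ∈ S}.Finite := by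
  induction n with
  | zero =>
    refine (Set.finite_singleton []).subset fun l hl => ?_
    exact List.length_eq_zero_iff.1 (Nat.le_zero.1 hl.1)
  | succ n ih =>
    refine ((Set.finite_singleton []).union (hS.image2 List.cons ih)).subset fun l hl => ?_
    cases l with
    | nil => simp
    | cons a l =>
      refine Or.inr (Set.mem_image2_of_mem (hl.2 a (by simp))
        ⟨?_, fun b hb => hl.2 b (by simp [hb])⟩)
      simpa using hl.1

/-! ### Instances of sound rules inside extended Frege derivations -/

theorem derivationSize_append (π π' : List Form) :
    derivationSize (π ++ π') = derivationSize π + derivationSize π' := by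
  simp [derivationSize]

theorem derivationSize_cons (A : Form) (π : List Form) :
    derivationSize (A :: π) = A.size + derivationSize π := by
  simp [derivationSize]

/-- A derivation of `C` from `Δ` in a Frege system can be replayed inside any extended Frege
derivation that contains an instance of `Δ`. The cost is linear in the size of the substituted
formulas, as the derivation of the scheme is fixed. If `C ∉ Δ` then the instance of `C` is the last
line. -/
theorem FregeDerivable.replay {F : FregeSystem} {Δ : List Form} {C : Form}
    (h : FregeDerivable F.rules Δ C) :
    ∃ c : ℕ, ∀ {P₀ P : QPrefix} {Γ π : List Form} {s : ℕ → Form} {M : ℕ},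
      (∀ v, (s v).Within M P.names) → EFregeDerivation F P₀ Γ P π →
      (∀ A ∈ Δ, A.subst s ∈ π) →
      ∃ π' : List Form, EFregeDerivation F P₀ Γ P (π' ++ π) ∧
        (C ∈ Δ ∨ (π' ++ π).head? = some (C.subst s)) ∧ derivationSize π' ≤ c * M := by
  induction h with
  | hyp h => exact ⟨0, fun _ d _ => ⟨[], d, Or.inl h, by simp [derivationSize]⟩⟩
  | @rule r hr t h ih =>
    have key : ∀ prems : List Form, (∀ A ∈ prems, A ∈ r.prems) →
        ∃ c : ℕ, ∀ {P₀ P : QPrefix} {Γ π : List Form} {s : ℕ → Form} {M : ℕ},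
          (∀ v, (s v).Within M P.names) → EFregeDerivation F P₀ Γ P π →
          (∀ A ∈ Δ, A.subst s ∈ π) →
          ∃ π' : List Form, EFregeDerivation F P₀ Γ P (π' ++ π) ∧
            (∀ A ∈ prems, (A.subst t).subst s ∈ π' ++ π) ∧ derivationSize π' ≤ c * M := by
      intro prems
      induction prems with
      | nil => exact fun _ => ⟨0, fun _ d _ => ⟨[], d, by simp, by simp [derivationSize]⟩⟩
      | cons A prems ihp =>
        intro hp
        obtain ⟨c₁, h₁⟩ := ih A (hp A (by simp))
        obtain ⟨c₂, h₂⟩ := ihp fun B hB => hp B (by simp [hB])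
        refine ⟨c₁ + c₂, fun {P₀ P Γ π s M} hs d hΔ => ?_⟩
        obtain ⟨π₂, d₂, m₂, z₂⟩ := h₂ hs d hΔ
        obtain ⟨π₁, d₁, m₁, z₁⟩ := h₁ hs d₂ fun B hB => List.mem_append_right _ (hΔ B hB)
        refine ⟨π₁ ++ π₂, by simpa using d₁, ?_, ?_⟩
        · intro B hB
          rcases List.mem_cons.1 hB with rfl | hB
          · rcases m₁ with m | m
            · simp [hΔ _ m]
            · simpa using List.mem_of_head? m
          · have := m₂ B hB
            simp only [List.mem_append] at this ⊢
            tauto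
        · rw [derivationSize_append, add_mul]; omega
    obtain ⟨c, hc⟩ := key r.prems fun _ h => h
    refine ⟨c + (r.concl.subst t).size, fun {P₀ P Γ π s M} hs d hΔ => ?_⟩
    obtain ⟨π', d', m', z'⟩ := hc hs d hΔ
    refine ⟨(r.concl.subst t).subst s :: π', ?_, Or.inr rfl, ?_⟩
    · refine EFregeDerivation.rule d' ⟨r, hr, fun v => (t v).subst s, ?_, ?_⟩ ?_
      · intro G hG
        rw [← Form.subst_subst]
        exact m' G hG
      · rw [Form.subst_subst]
      · exact Form.vars_subst (fun v => (hs v).2) _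
    · rw [derivationSize_cons, add_mul]
      have := Form.size_subst_le (fun v => (hs v).1) (r.concl.subst t)
      omega

/-- One constant serves for all small sound rules, as there are only finitely many of them. -/
theorem FregeSystem.exists_small_rules_constant (F : FregeSystem) :
    ∃ c : ℕ, ∀ (Δ : List Form) (C : Form), Δ.length ≤ 4 → (∀ A ∈ Δ, A.Small) → C.Small →
      (∀ v : ℕ → Prop, (∀ A ∈ Δ, A.eval v) → C.eval v) →
      ∀ {P₀ P : QPrefix} {Γ π : List Form} {l : List Form} {M : ℕ}, 1 ≤ M →
        (∀ A ∈ l, A.Within M P.names) → EFregeDerivation F P₀ Γ P π →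
        (∀ A ∈ Δ, A.subst (Form.inst l) ∈ π) →
        ∃ π' : List Form, EFregeDerivation F P₀ Γ P (π' ++ π) ∧
          (C ∈ Δ ∨ (π' ++ π).head? = some (C.subst (Form.inst l))) ∧
          derivationSize π' ≤ c * M := by
  have hfin :
      {r : List Form × Form | r.1.length ≤ 4 ∧ (∀ A ∈ r.1, A.Small) ∧ r.2.Small}.Finite := by
    refine ((finite_lists_length_le (Form.finite_size_le 60 20) 4).prod
      (Form.finite_size_le 60 20)).subset ?_
    rintro ⟨Δ, C⟩ ⟨h₁, h₂, h₃⟩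
    exact ⟨⟨h₁, h₂⟩, h₃⟩
  have hex : ∀ r : List Form × Form, ∃ c : ℕ,
      (∀ v : ℕ → Prop, (∀ A ∈ r.1, A.eval v) → r.2.eval v) →
      ∀ {P₀ P : QPrefix} {Γ π : List Form} {s : ℕ → Form} {M : ℕ},
        (∀ v, (s v).Within M P.names) → EFregeDerivation F P₀ Γ P π →
        (∀ A ∈ r.1, A.subst s ∈ π) →
        ∃ π' : List Form, EFregeDerivation F P₀ Γ P (π' ++ π) ∧
          (r.2 ∈ r.1 ∨ (π' ++ π).head? = some (r.2.subst s)) ∧ derivationSize π' ≤ c * M := by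
    intro r
    by_cases hr : ∀ v : ℕ → Prop, (∀ A ∈ r.1, A.eval v) → r.2.eval v
    · obtain ⟨c, hc⟩ := (F.complete r.1 r.2 hr).replay
      exact ⟨c, fun _ => hc⟩
    · exact ⟨0, fun h => absurd h hr⟩
  choose c hc using hex
  obtain ⟨m, hm⟩ := (hfin.image c).bddAbove
  refine ⟨m, fun Δ C h₁ h₂ h₃ hs {P₀ P Γ π l M} hM hl d hΔ => ?_⟩
  obtain ⟨π', d', m', z'⟩ := hc (Δ, C) hs (Form.within_inst hM hl) d hΔ
  exact ⟨π', d', m', z'.trans (Nat.mul_le_mul_right _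
    (hm (Set.mem_image_of_mem c (show (Δ, C) ∈ _ from ⟨h₁, h₂, h₃⟩))))⟩

/-! ### Derivability with a cost -/

/-- `D k A` is a notion of derivability of `A` in at most `k` steps, where a step is an instance of
a small sound rule by formulas satisfying `K`. -/
structure CostDerivability (K : Form → Prop) (D : ℕ → Form → Prop) : Prop where
  mono : ∀ {k k' : ℕ} {A : Form}, D k A → k ≤ k' → D k' A
  step : ∀ (Δ : List Form) (C : Form) (l : List Form) {ks : List ℕ},
    List.Forall₂ (fun k A => D k (A.subst (Form.inst l))) ks Δ → (∀ A ∈ l, K A) →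
    (∀ v : ℕ → Prop, (∀ A ∈ Δ, A.eval v) → C.eval v) →
    (Δ.length ≤ 4 ∧ (∀ A ∈ Δ, A.Small) ∧ C.Small) →
    D (ks.sum + 1) (C.subst (Form.inst l))

/-- `A` can be added to every derivation that contains the lines `π₀`, by new lines of total size at
most `k * W`. -/
def Reach (F : FregeSystem) (P₀ : QPrefix) (Γ : List Form) (P : QPrefix) (π₀ : List Form)
    (W k : ℕ) (A : Form) : Prop :=
  ∀ π : List Form, π₀ ⊆ π → EFregeDerivation F P₀ Γ P π →
    ∃ π' : List Form, EFregeDerivation F P₀ Γ P (π' ++ π) ∧ A ∈ π' ++ π ∧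
      derivationSize π' ≤ k * W

theorem reach_of_mem {F : FregeSystem} {P₀ : QPrefix} {Γ : List Form} {P : QPrefix}
    {π₀ : List Form} {W : ℕ} {A : Form} (h : A ∈ π₀) : Reach F P₀ Γ P π₀ W 0 A :=
  fun _ hπ d => ⟨[], d, hπ h, by simp [derivationSize]⟩

/-- Adding lines to a derivation is a `CostDerivability`; moreover, a line that is already present
can be repeated at the end. -/
theorem FregeSystem.exists_costDerivability (F : FregeSystem) :
    ∃ c : ℕ, ∀ (P₀ : QPrefix) (Γ : List Form) (P : QPrefix) (π₀ : List Form) (M : ℕ), 1 ≤ M →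
      CostDerivability (Form.Within M P.names) (Reach F P₀ Γ P π₀ (c * M)) ∧
      ∀ (A : Form) (π : List Form), A.Within M P.names → A ∈ π →
        EFregeDerivation F P₀ Γ P π → ∃ π' : List Form, EFregeDerivation F P₀ Γ P (π' ++ π) ∧
          (π' ++ π).head? = some A ∧ derivationSize π' ≤ 2 * (c * M) := by
  obtain ⟨c, hc⟩ := F.exists_small_rules_constant
  refine ⟨c, fun P₀ Γ P π₀ M hM => ⟨⟨?_, ?_⟩, ?_⟩⟩
  · intro k k' A h hk π hπ d
    obtain ⟨π', d', m', z'⟩ := h π hπ d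
    exact ⟨π', d', m', z'.trans (Nat.mul_le_mul_right _ hk)⟩
  · intro Δ C l ks hks hl hs ⟨h₁, h₂, h₃⟩ π hπ d
    have key : ∃ π' : List Form, EFregeDerivation F P₀ Γ P (π' ++ π) ∧
        (∀ A ∈ Δ, A.subst (Form.inst l) ∈ π' ++ π) ∧ derivationSize π' ≤ ks.sum * (c * M) := by
      clear hs h₁ h₂ h₃
      induction hks with
      | nil => exact ⟨[], d, by simp, by simp [derivationSize]⟩
      | @cons k A ks Δ hA _ ih =>
        obtain ⟨π₁, d₁, m₁, z₁⟩ := ih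
        obtain ⟨π₂, d₂, m₂, z₂⟩ := hA (π₁ ++ π) (List.subset_append_of_subset_right _ hπ) d₁
        refine ⟨π₂ ++ π₁, by simpa using d₂, ?_, ?_⟩
        · intro B hB
          rcases List.mem_cons.1 hB with rfl | hB
          · simpa using m₂
          · have := m₁ B hB
            simp only [List.mem_append] at this ⊢
            tauto
        · rw [derivationSize_append, List.sum_cons, add_mul]; omega
    obtain ⟨π₁, d₁, m₁, z₁⟩ := key
    obtain ⟨π₂, d₂, m₂, z₂⟩ := hc Δ C h₁ h₂ h₃ hs hM hl d₁ m₁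
    refine ⟨π₂ ++ π₁, by simpa using d₂, ?_, ?_⟩
    · rcases m₂ with m | m
      · have := m₁ C m
        simp only [List.mem_append] at this ⊢
        tauto
      · simpa using List.mem_of_head? m
    · rw [derivationSize_append, add_mul, one_mul]; omega
  · intro A π hA hAπ d
    -- The detour through `A ∧ A` makes sure that `A` is derived anew.
    obtain ⟨π₁, d₁, m₁, z₁⟩ := hc [.var 0] (.and (.var 0) (.var 0)) (by decide) (by decide)
      (by decide) (by simp [Form.eval]) (l := [A]) hM (by simpa using hA) d
      (by simpa [Form.subst, Form.inst] using hAπ)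
    have m₁' := List.mem_of_head? (m₁.resolve_left (by simp))
    obtain ⟨π₂, d₂, m₂, z₂⟩ := hc [.and (.var 0) (.var 0)] (.var 0) (by decide) (by decide)
      (by decide) (by simp [Form.eval]) (l := [A]) hM (by simpa using hA) d₁
      (by simpa using m₁')
    have m₂' := m₂.resolve_left (by simp)
    refine ⟨π₂ ++ π₁, by simpa using d₂, by simpa [Form.subst, Form.inst] using m₂', ?_⟩
    rw [derivationSize_append]; omega

/-! ### Large conjunctions and disjunctions -/

open Form

theorem Form.Within.of_and {M : ℕ} {V : List ℕ} {A B : Form} (h : (and A B).Within M V) :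
    A.Within M V ∧ B.Within M V := by
  simp only [Within, size, vars, Finset.mem_union] at h ⊢
  exact ⟨⟨by omega, fun v hv => h.2 v (Or.inl hv)⟩, ⟨by omega, fun v hv => h.2 v (Or.inr hv)⟩⟩

theorem Form.Within.of_or {M : ℕ} {V : List ℕ} {A B : Form} (h : (or A B).Within M V) :
    A.Within M V ∧ B.Within M V :=
  Within.of_and (A := A) (B := B) h

theorem Form.Within.of_mem_bigAnd {M : ℕ} {V : List ℕ} {A : Form} {l : List Form}
    (h : (bigAnd l).Within M V) (hA : A ∈ l) : A.Within M V := by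
  induction l with
  | nil => simp at hA
  | cons B l ih =>
    rcases List.mem_cons.1 hA with rfl | hA
    exacts [h.of_and.1, ih h.of_and.2 hA]

theorem Form.Within.of_mem_bigOr {M : ℕ} {V : List ℕ} {A : Form} {l : List Form}
    (h : (bigOr l).Within M V) (hA : A ∈ l) : A.Within M V := by
  induction l with
  | nil => simp at hA
  | cons B l ih =>
    rcases List.mem_cons.1 hA with rfl | hA
    exacts [h.of_or.1, ih h.of_or.2 hA]

namespace CostDerivability

variable {M : ℕ} {V : List ℕ} {D : ℕ → Form → Prop}

theorem bigAnd_elim (hD : CostDerivability (Within M V) D) {As : List Form}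
    (hK : (bigAnd As).Within M V) {A : Form} (hA : A ∈ As) :
    D As.length (imp (bigAnd As) A) := by
  induction As with
  | nil => simp at hA
  | cons B As ih =>
    have hK' := hK.of_and
    have hAK := hK.of_mem_bigAnd hA
    rcases List.mem_cons.1 hA with rfl | hA
    · exact hD.mono (hD.step [] (imp (and (var 0) (var 1)) (var 0)) [A, bigAnd As] .nil
        (by simpa using hK') (by simp [eval]; tauto) (by decide)) (by simp)
    · exact hD.mono (hD.step [imp (var 1) (var 2)] (imp (and (var 0) (var 1)) (var 2))
        [B, bigAnd As, A] (.cons (ih hK'.2 hA) .nil) (by simp [*])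
        (by simp [eval]; tauto) (by decide)) (by simp)

theorem bigOr_intro (hD : CostDerivability (Within M V) D) {As : List Form}
    (hK : (bigOr As).Within M V) {A : Form} (hA : A ∈ As) :
    D As.length (imp A (bigOr As)) := by
  induction As with
  | nil => simp at hA
  | cons B As ih =>
    have hK' := hK.of_or
    have hAK := hK.of_mem_bigOr hA
    rcases List.mem_cons.1 hA with rfl | hA
    · exact hD.mono (hD.step [] (imp (var 0) (or (var 0) (var 1))) [A, bigOr As] .nil
        (by simpa using hK') (by simp [eval]; tauto) (by decide)) (by simp)
    · exact hD.mono (hD.step [imp (var 2) (var 1)] (imp (var 2) (or (var 0) (var 1)))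
        [B, bigOr As, A] (.cons (ih hK'.2 hA) .nil) (by simp [*])
        (by simp [eval]; tauto) (by decide)) (by simp)

theorem bigAnd_map (hD : CostDerivability (Within M V) D) {H : Form} (hH : H.Within M V) {k : ℕ}
    {As Bs : List Form} (h : List.Forall₂ (fun A B => D k (imp H (imp A B))) As Bs)
    (hA : (bigAnd As).Within M V) (hB : (bigAnd Bs).Within M V) :
    D (As.length * (k + 1) + 1) (imp H (imp (bigAnd As) (bigAnd Bs))) := by
  induction h with
  | nil =>
    exact hD.mono (hD.step [] (imp (var 0) (imp tru tru)) [H] .nil (by simpa using hH)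
      (by simp [eval]) (by decide)) (by simp)
  | @cons A B As Bs hAB _ ih =>
    have hA' := hA.of_and
    have hB' := hB.of_and
    refine hD.mono (hD.step [imp (var 0) (imp (var 1) (var 2)), imp (var 0) (imp (var 3) (var 4))]
      (imp (var 0) (imp (and (var 1) (var 3)) (and (var 2) (var 4))))
      [H, A, B, bigAnd As, bigAnd Bs] (.cons hAB (.cons (ih hA'.2 hB'.2) .nil)) (by simp [*])
      (by simp [eval]; tauto) (by decide)) ?_
    simp only [List.length_cons, List.sum_cons, List.sum_nil, add_mul]
    omega

theorem bigOr_elim (hD : CostDerivability (Within M V) D) {H E : Form} (hH : H.Within M V)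
    (hE : E.Within M V) {k : ℕ} {As : List Form} (h : ∀ A ∈ As, D k (imp H (imp A E)))
    (hA : (bigOr As).Within M V) :
    D (As.length * (k + 1) + 1) (imp H (imp (bigOr As) E)) := by
  induction As with
  | nil =>
    exact hD.mono (hD.step [] (imp (var 0) (imp fls (var 1))) [H, E] .nil (by simp [*])
      (by simp [eval]) (by decide)) (by simp)
  | cons A As ih =>
    have hA' := hA.of_or
    refine hD.mono (hD.step [imp (var 0) (imp (var 1) (var 2)), imp (var 0) (imp (var 3) (var 2))]
      (imp (var 0) (imp (or (var 1) (var 3)) (var 2)))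
      [H, A, E, bigOr As] (.cons (h A (by simp)) (.cons (ih (fun B hB => h B (by simp [hB])) hA'.2)
        .nil)) (by simp [*]) (by simp [eval]; tauto) (by decide)) ?_
    simp only [List.length_cons, List.sum_cons, List.sum_nil, add_mul]
    omega

end CostDerivability

/-! ### Replacing one policy by another -/

/-- The policies `B` and `S` act alike at the universal variable `u`. -/
def Policy.same (B S : Policy) (u : ℕ) : Form :=
  and (iff (var (B.setVar u)) (var (S.setVar u)))
    (imp (var (S.setVar u)) (iff (var (B.valVar u)) (var (S.valVar u))))

theorem Policy.length_annConj_le (S : Policy) (P : QPrefix) (x : ℕ) (τ : Annotation) :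
    ((QPrefix.universals P).flatMap (S.annConj P x τ)).length ≤
      (QPrefix.universals P).length := by
  rw [List.length_flatMap]
  refine (List.sum_le_card_nsmul _ 1 ?_).trans (by simp)
  simp only [List.mem_map, forall_exists_index, and_imp]
  rintro _ u _ rfl
  unfold Policy.annConj
  split <;> [skip; skip; split] <;> simp

namespace CostDerivability

variable {M : ℕ} {V : List ℕ} {D : ℕ → Form → Prop}

theorem toForm_transfer (hD : CostDerivability (Within M V) D) {P P' : QPrefix} {B S : Policy}
    (hP : QPrefix.universals P' = QPrefix.universals P) {H : Form} (hH : H.Within M V) {k n : ℕ}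
    (h : ∀ u ∈ QPrefix.universals P, D k (imp H (B.same S u)))
    (hB : (B.toForm P').Within M V) (hS : (S.toForm P).Within M V)
    (hV : ∀ u ∈ QPrefix.universals P, ∀ v ∈ [u, B.setVar u, B.valVar u, S.setVar u, S.valVar u],
      (var v).Within M V) (hn : (QPrefix.universals P).length ≤ n) :
    D (n * (k + 2) + 1) (imp H (imp (B.toForm P') (S.toForm P))) := by
  refine hD.mono (hD.bigAnd_map hH (k := k + 1) ?_ hB hS)
    (by rw [List.length_map, hP]; gcongr)
  rw [hP, List.forall₂_map_left_iff, List.forall₂_map_right_iff, List.forall₂_same]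
  intro u hu
  have wV := hV u hu
  simp only [List.forall_mem_cons] at wV
  exact hD.mono (hD.step
    [imp (var 0) (and (iff (var 1) (var 2)) (imp (var 2) (iff (var 3) (var 4))))]
    (imp (var 0) (imp (imp (var 1) (iff (var 5) (var 3))) (imp (var 2) (iff (var 5) (var 4)))))
    [H, var (B.setVar u), var (S.setVar u), var (B.valVar u), var (S.valVar u), var u]
    (.cons (h u hu) .nil) (by simp [*]) (by simp [eval]; tauto) (by decide)) (by simp)

theorem conLit_transfer (hD : CostDerivability (Within M V) D) {P P' : QPrefix} {B S : Policy}
    (hP : QPrefix.universals P' = QPrefix.universals P) {H : Form} (hH : H.Within M V) {k n : ℕ}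
    (h : ∀ u ∈ QPrefix.universals P, D k (imp H (B.same S u))) {l : AnnLit}
    (hl : ∀ u ∈ QPrefix.universals P, P'.LeftOf u l.x ↔ P.LeftOf u l.x)
    (hB : (B.conLit P' l).Within M V) (hS : (S.conLit P l).Within M V)
    (hV : ∀ u ∈ QPrefix.universals P, ∀ v ∈ [u, B.setVar u, B.valVar u, S.setVar u, S.valVar u],
      (var v).Within M V) (hn : (QPrefix.universals P).length ≤ n) :
    D (n * (k + 2) + 2) (imp H (imp (S.conLit P l) (B.conLit P' l))) := by
  have hB' : _ ∧ (B.ann P' l.x l.τ).Within M V := Within.of_and hB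
  have hS' : (S.ann P l.x l.τ).Within M V := (Within.of_and hS).2
  have hlen := (S.length_annConj_le P l.x l.τ).trans hn
  have key := hD.bigAnd_map hH (k := k + 1) ?_ hS' hB'.2
  · exact hD.mono (hD.step [imp (var 0) (imp (var 1) (var 2))]
      (imp (var 0) (imp (and (var 3) (var 1)) (and (var 3) (var 2))))
      [H, S.ann P l.x l.τ, B.ann P' l.x l.τ, if l.pos then var l.x else neg (var l.x)]
      (.cons key .nil) (by simp [*]) (by simp [eval]; tauto) (by decide))
      (by simpa only [List.sum_cons, List.sum_nil, add_zero, add_assoc] using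
        Nat.add_le_add_right (Nat.mul_le_mul_right _ hlen) 2)
  · rw [hP]
    refine List.rel_flatMap (R := fun u u' => u = u' ∧ u ∈ QPrefix.universals P)
      (List.forall₂_same.2 fun u hu => ⟨rfl, hu⟩) ?_
    rintro u _ ⟨rfl, hu⟩
    have wV := hV u hu
    simp only [List.forall_mem_cons] at wV
    have step (C : Form) (hs : ∀ v : ℕ → Prop, ((v 0 → (v 1 ↔ v 2) ∧ (v 2 → (v 3 ↔ v 4))) →
        C.eval v)) (hC : C.Small) : D (k + 1) (C.subst (inst [H, var (B.setVar u),
          var (S.setVar u), var (B.valVar u), var (S.valVar u), var u])) :=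
      hD.mono (hD.step
        [imp (var 0) (and (iff (var 1) (var 2)) (imp (var 2) (iff (var 3) (var 4))))] C _
        (.cons (h u hu) .nil) (by simp [*]) (fun v hv => hs v (by simpa [eval] using hv))
        ⟨by simp, by decide, hC⟩) (by simp)
    unfold Policy.annConj
    split
    · exact .cons (step (imp (var 0) (imp (and (var 2) (var 5)) (and (var 1) (var 5))))
        (by simp [eval]; tauto) (by decide)) .nil
    · exact .cons (step (imp (var 0) (imp (and (var 2) (neg (var 5))) (and (var 1) (neg (var 5)))))
        (by simp [eval]; tauto) (by decide)) .nil
    · by_cases hu' : P.LeftOf u l.x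
      · rw [if_pos hu', if_pos ((hl u hu).2 hu')]
        exact .cons (step (imp (var 0) (imp (neg (var 2)) (neg (var 1))))
          (by simp [eval]; tauto) (by decide)) .nil
      · rw [if_neg hu', if_neg (mt (hl u hu).1 hu')]
        exact .nil

/-- The number of steps in which the claim of a policy is carried over to a policy that acts alike,
when there are at most `n` universal variables and literals and the hypotheses take `k` steps. -/
def transferCost (n k : ℕ) : ℕ := n * (n * (k + 2) + n + 4 + 2 * k + 1) + n * (k + 2) + 4 + 2 * k

/-- If under the assumption `H` the policy `B` is followed and acts like `S`, and if the literal
`l₀` cannot be the one that makes the clause of `S` true, then the other literals of this clause do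
so for `B`. -/
theorem con_of_same (hD : CostDerivability (Within M V) D) {P P' : QPrefix} {B S : Policy}
    (hP : QPrefix.universals P' = QPrefix.universals P) {H : Form} (hH : H.Within M V) {k n : ℕ}
    (h : ∀ u ∈ QPrefix.universals P, D k (imp H (B.same S u))) {C C' : AnnClause} {l₀ : AnnLit}
    (hl : ∀ l ∈ C, ∀ u ∈ QPrefix.universals P, P'.LeftOf u l.x ↔ P.LeftOf u l.x) (hC : C ⊆ C')
    (hB : (B.toForm P').Within M V) (hS : (S.toForm P).Within M V)
    (hBC : (B.con P' C').Within M V) (hSC : (S.con P (C ++ [l₀])).Within M V)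
    (hV : ∀ u ∈ QPrefix.universals P, ∀ v ∈ [u, B.setVar u, B.valVar u, S.setVar u, S.valVar u],
      (var v).Within M V)
    (hn : (QPrefix.universals P).length ≤ n) (hCn : (C ++ [l₀]).length ≤ n) (hCn' : C'.length ≤ n)
    (hG : D k (imp H (B.toForm P'))) (hp : D k (S.claim P (C ++ [l₀])))
    (h₀ : D k (imp H (imp (S.toForm P) (neg (S.conLit P l₀))))) :
    D (transferCost n k) (imp H (B.con P' C')) := by
  have hS' := hD.toForm_transfer hP hH h hB hS hV hn
  have hHS : D (k + (n * (k + 2) + 1) + 1) (imp H (S.toForm P)) :=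
    hD.mono (hD.step [imp (var 0) (var 1), imp (var 0) (imp (var 1) (var 2))]
      (imp (var 0) (var 2)) [H, B.toForm P', S.toForm P] (.cons hG (.cons hS' .nil))
      (by simp [*]) (by simp [eval]; tauto) (by decide)) (by simp)
  have hlit : ∀ A ∈ (C ++ [l₀]).map (S.conLit P),
      D (n * (k + 2) + n + 4 + 2 * k) (imp H (imp A (B.con P' C'))) := by
    simp only [List.mem_map, forall_exists_index, and_imp]
    rintro _ l hmem rfl
    have hSl := hSC.of_mem_bigOr (List.mem_map_of_mem hmem)
    rcases List.mem_append.1 hmem with hlC | hl₀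
    · have hBl := hBC.of_mem_bigOr (List.mem_map_of_mem (hC hlC))
      have h₁ := hD.conLit_transfer hP hH h (hl l hlC) hBl hSl hV hn
      have h₂ := hD.bigOr_intro hBC (List.mem_map_of_mem (hC hlC))
      rw [List.length_map] at h₂
      exact hD.mono (hD.step [imp (var 0) (imp (var 1) (var 2)), imp (var 2) (var 3)]
        (imp (var 0) (imp (var 1) (var 3))) [H, S.conLit P l, B.conLit P' l, B.con P' C']
        (.cons h₁ (.cons h₂ .nil)) (by simp [*]) (by simp [eval]; tauto) (by decide))
        (by simp only [List.sum_cons, List.sum_nil]; omega)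
    · obtain rfl := List.mem_singleton.1 hl₀
      exact hD.mono (hD.step [imp (var 0) (var 1), imp (var 0) (imp (var 1) (neg (var 2)))]
        (imp (var 0) (imp (var 2) (var 3))) [H, S.toForm P, S.conLit P l, B.con P' C']
        (.cons hHS (.cons h₀ .nil)) (by simp [*]) (by simp [eval]; tauto) (by decide))
        (by simp only [List.sum_cons, List.sum_nil]; omega)
  have hor := hD.bigOr_elim hH hBC hlit hSC
  rw [List.length_map] at hor
  have hor' := hD.mono hor (Nat.add_le_add_right (Nat.mul_le_mul_right _ hCn) 1)
  refine hD.mono (hD.step [imp (var 0) (var 1), imp (var 1) (var 2),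
    imp (var 0) (imp (var 2) (var 3))] (imp (var 0) (var 3))
    [H, S.toForm P, S.con P (C ++ [l₀]), B.con P' C']
    (.cons hHS (.cons hp (.cons hor' .nil))) (by simp [*]) (by simp [eval]; tauto) (by decide)) ?_
  simp only [List.sum_cons, List.sum_nil, transferCost]
  omega

end CostDerivability

/-! ### The choice between two policies -/

namespace Policy

/-- The policy `S` acts at `u` as the annotation `τ` prescribes. -/
def agree (S : Policy) (τ : Annotation) (u : ℕ) : Form :=
  match τ u with
  | some true => and (var (S.setVar u)) (var (S.valVar u))
  | some false => and (var (S.setVar u)) (neg (var (S.valVar u)))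
  | none => neg (var (S.setVar u))

/-- The policy `S` agrees with `τ` on a list of universal variables. -/
def agreeAll (S : Policy) (τ : Annotation) : List ℕ → Form
  | [] => tru
  | u :: r => and (S.agree τ u) (S.agreeAll τ r)

/-- Some variable of the list is one at which `L` differs from `τ`, and `R` agrees with `τ` on all
variables quantified before it. The list holds universal variables from right to left. -/
def differsFirst (L R : Policy) (τ : Annotation) : List ℕ → Form
  | [] => fls
  | u :: r => or (differsFirst L R τ r) (and (neg (L.agree τ u)) (R.agreeAll τ r))

/-- The formula that decides which of the policies `L` and `R` is followed once all the variables of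
the list, which are the universal variables left of `x`, are passed: true stands for `L`. If neither
policy differs from `τ`, the value of `x` decides. -/
def choice (L R : Policy) (τ : Annotation) (x : ℕ) (r : List ℕ) : Form :=
  or (differsFirst L R τ r) (and (R.agreeAll τ r) (var x))

theorem size_agree_le (S : Policy) (τ : Annotation) (u : ℕ) : (S.agree τ u).size ≤ 4 := by
  unfold agree
  split <;> simp [size]

theorem size_agreeAll_le (S : Policy) (τ : Annotation) (r : List ℕ) :
    (S.agreeAll τ r).size ≤ 5 * r.length + 1 := by
  induction r with
  | nil => simp [agreeAll, size]
  | cons u r ih =>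
    have := S.size_agree_le τ u
    simp only [agreeAll, size, List.length_cons]
    omega

theorem size_differsFirst_le (L R : Policy) (τ : Annotation) {n : ℕ} {r : List ℕ}
    (hr : r.length ≤ n) : (differsFirst L R τ r).size ≤ r.length * (5 * n + 8) + 1 := by
  induction r with
  | nil => simp [differsFirst, size]
  | cons u r ih =>
    have h₁ := L.size_agree_le τ u
    have h₂ := R.size_agreeAll_le τ r
    simp only [List.length_cons] at hr
    have h₃ := ih (by omega)
    simp only [differsFirst, size, List.length_cons, add_mul, one_mul]
    omega

theorem size_choice_le (L R : Policy) (τ : Annotation) (x : ℕ) {n : ℕ} {r : List ℕ}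
    (hr : r.length ≤ n) : (choice L R τ x r).size ≤ n * (5 * n + 8) + 5 * n + 5 := by
  have h₁ := size_differsFirst_le L R τ hr
  have h₂ := R.size_agreeAll_le τ r
  have h₃ := Nat.mul_le_mul_right (5 * n + 8) hr
  simp only [choice, size]
  omega

theorem vars_agree (S : Policy) (τ : Annotation) {u v : ℕ} (hv : v ∈ (S.agree τ u).vars) :
    v = S.setVar u ∨ v = S.valVar u := by
  unfold agree at hv
  split at hv <;> simp [vars] at hv <;> tauto

theorem vars_agreeAll (S : Policy) (τ : Annotation) {r : List ℕ} {v : ℕ}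
    (hv : v ∈ (S.agreeAll τ r).vars) : ∃ u ∈ r, v = S.setVar u ∨ v = S.valVar u := by
  induction r with
  | nil => simp [agreeAll, vars] at hv
  | cons u r ih =>
    rcases Finset.mem_union.1 hv with h | h
    · exact ⟨u, by simp, S.vars_agree τ h⟩
    · obtain ⟨w, hw, h⟩ := ih h
      exact ⟨w, by simp [hw], h⟩

theorem vars_differsFirst {L R : Policy} {τ : Annotation} {r : List ℕ} {v : ℕ}
    (hv : v ∈ (differsFirst L R τ r).vars) :
    ∃ u ∈ r, v = L.setVar u ∨ v = L.valVar u ∨ v = R.setVar u ∨ v = R.valVar u := by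
  induction r with
  | nil => simp [differsFirst, vars] at hv
  | cons u r ih =>
    simp only [differsFirst, vars, Finset.mem_union] at hv
    rcases hv with h | h | h
    · obtain ⟨w, hw, h⟩ := ih h
      exact ⟨w, by simp [hw], h⟩
    · have := L.vars_agree τ h
      exact ⟨u, by simp, by tauto⟩
    · obtain ⟨w, hw, h⟩ := R.vars_agreeAll τ h
      exact ⟨w, by simp [hw], by tauto⟩

theorem vars_choice {L R : Policy} {τ : Annotation} {x : ℕ} {r : List ℕ} {v : ℕ}
    (hv : v ∈ (choice L R τ x r).vars) :
    (∃ u ∈ r, v = L.setVar u ∨ v = L.valVar u ∨ v = R.setVar u ∨ v = R.valVar u) ∨ v = x := by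
  simp only [choice, vars, Finset.mem_union, Finset.mem_singleton] at hv
  rcases hv with h | h | h
  · exact Or.inl (vars_differsFirst h)
  · obtain ⟨w, hw, h⟩ := R.vars_agreeAll τ h
    exact Or.inl ⟨w, hw, by tauto⟩
  · exact Or.inr h

end Policy

/-- If `s` then `A` else `B`. -/
def Form.ite (s A B : Form) : Form := or (and s A) (and (neg s) B)

namespace CostDerivability

variable {M : ℕ} {V : List ℕ} {D : ℕ → Form → Prop}

/-- While the policy `S` is followed, `ann_{x,S}(τ)` says that `S` agrees with `τ` left of `x`. -/
theorem agree_of_ann (hD : CostDerivability (Within M V) D) {P : QPrefix} {S : Policy} {x : ℕ}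
    {τ : Annotation} (hS : (S.toForm P).Within M V) (hA : (S.ann P x τ).Within M V) {n : ℕ}
    (hn : (QPrefix.universals P).length ≤ n) {u : ℕ} (hu : u ∈ QPrefix.universals P)
    (hux : P.LeftOf u x) (hV : ∀ v ∈ [u, S.setVar u, S.valVar u], (var v).Within M V) :
    D (2 * n + 1) (imp (and (S.toForm P) (S.ann P x τ)) (S.agree τ u)) := by
  simp only [List.forall_mem_cons] at hV
  have h₁ := hD.mono (hD.bigAnd_elim hS (List.mem_map_of_mem hu)) (by simpa using hn)
  have h₂ {A : Form} (hA' : A ∈ S.annConj P x τ u) : D n (imp (S.ann P x τ) A) :=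
    hD.mono (hD.bigAnd_elim hA (List.mem_flatMap.2 ⟨u, hu, hA'⟩))
      ((S.length_annConj_le P x τ).trans hn)
  unfold Policy.annConj at h₂
  unfold Policy.agree
  rcases hτ : τ u with _ | _ | _ <;> simp only [hτ] at h₂
  · exact hD.mono (hD.step
      [imp (var 0) (imp (var 3) (iff (var 2) (var 4))), imp (var 1) (neg (var 3))]
      (imp (and (var 0) (var 1)) (neg (var 3)))
      [S.toForm P, S.ann P x τ, var u, var (S.setVar u), var (S.valVar u)]
      (.cons h₁ (.cons (h₂ (A := neg (var (S.setVar u))) (by simp [hux])) .nil))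
      (by simp [*]) (by simp [eval]; tauto) (by decide))
      (by simp only [List.sum_cons, List.sum_nil]; omega)
  · exact hD.mono (hD.step
      [imp (var 0) (imp (var 3) (iff (var 2) (var 4))), imp (var 1) (and (var 3) (neg (var 2)))]
      (imp (and (var 0) (var 1)) (and (var 3) (neg (var 4))))
      [S.toForm P, S.ann P x τ, var u, var (S.setVar u), var (S.valVar u)]
      (.cons h₁ (.cons (h₂ (A := and (var (S.setVar u)) (neg (var u))) (by simp)) .nil))
      (by simp [*]) (by simp [eval]; tauto) (by decide))
      (by simp only [List.sum_cons, List.sum_nil]; omega)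
  · exact hD.mono (hD.step
      [imp (var 0) (imp (var 3) (iff (var 2) (var 4))), imp (var 1) (and (var 3) (var 2))]
      (imp (and (var 0) (var 1)) (and (var 3) (var 4)))
      [S.toForm P, S.ann P x τ, var u, var (S.setVar u), var (S.valVar u)]
      (.cons h₁ (.cons (h₂ (A := and (var (S.setVar u)) (var u)) (by simp)) .nil))
      (by simp [*]) (by simp [eval]; tauto) (by decide))
      (by simp only [List.sum_cons, List.sum_nil]; omega)

theorem agreeAll_of_agree (hD : CostDerivability (Within M V) D) {S : Policy} {τ : Annotation}
    {Z : Form} (hZ : Z.Within M V) {k : ℕ} {r : List ℕ}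
    (h : ∀ u ∈ r, D k (imp Z (S.agree τ u))) (hr : (S.agreeAll τ r).Within M V) :
    D (r.length * (k + 1) + 1) (imp Z (S.agreeAll τ r)) := by
  induction r with
  | nil =>
    exact hD.mono (hD.step [] (imp (var 0) tru) [Z] .nil (by simpa using hZ) (by simp [eval])
      (by decide)) (by simp)
  | cons u r ih =>
    have hr' : _ ∧ _ := Within.of_and hr
    refine hD.mono (hD.step [imp (var 0) (var 1), imp (var 0) (var 2)]
      (imp (var 0) (and (var 1) (var 2))) [Z, S.agree τ u, S.agreeAll τ r]
      (.cons (h u (by simp)) (.cons (ih (fun w hw => h w (by simp [hw])) hr'.2) .nil))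
      (by simp [*]) (by simp [eval]; tauto) (by decide)) ?_
    simp only [List.length_cons, List.sum_cons, List.sum_nil, add_mul]
    omega

theorem not_differsFirst_of_agree (hD : CostDerivability (Within M V) D) {L R : Policy}
    {τ : Annotation} {Z : Form} (hZ : Z.Within M V) {k : ℕ} {r : List ℕ}
    (h : ∀ u ∈ r, D k (imp Z (L.agree τ u))) (hr : (Policy.differsFirst L R τ r).Within M V) :
    D (r.length * (k + 1) + 1) (imp Z (neg (Policy.differsFirst L R τ r))) := by
  induction r with
  | nil =>
    exact hD.mono (hD.step [] (imp (var 0) (neg fls)) [Z] .nil (by simpa using hZ) (by simp [eval])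
      (by decide)) (by simp)
  | cons u r ih =>
    have hr' : _ ∧ _ := Within.of_or hr
    have hr'' : _ ∧ _ := Within.of_and hr'.2
    have hL : (L.agree τ u).Within M V := by
      have := hr''.1
      simp only [Within, size, vars] at this ⊢
      exact ⟨by omega, this.2⟩
    refine hD.mono (hD.step [imp (var 0) (var 1), imp (var 0) (neg (var 2))]
      (imp (var 0) (neg (or (var 2) (and (neg (var 1)) (var 3)))))
      [Z, L.agree τ u, Policy.differsFirst L R τ r, R.agreeAll τ r]
      (.cons (h u (by simp)) (.cons (ih (fun w hw => h w (by simp [hw])) hr'.1) .nil))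
      (by simp [*]) (by simp [eval]; tauto) (by decide)) ?_
    simp only [List.length_cons, List.sum_cons, List.sum_nil, add_mul]
    omega

/-- How the state of the comparison after the variables `w` depends on the state after further
variables `t`: being first to differ is preserved, agreement is inherited, and a policy `L` that
differs first later on leaves `R` in agreement up to `w`. -/
theorem differsFirst_append (hD : CostDerivability (Within M V) D) {L R : Policy} {τ : Annotation}
    {t w : List ℕ} (h₁ : (Policy.differsFirst L R τ (t ++ w)).Within M V)
    (h₂ : (R.agreeAll τ (t ++ w)).Within M V) :
    (Policy.differsFirst L R τ w).Within M V ∧ (R.agreeAll τ w).Within M V ∧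
    D (t.length + 1) (and (imp (Policy.differsFirst L R τ (t ++ w))
        (or (Policy.differsFirst L R τ w) (R.agreeAll τ w)))
      (and (imp (R.agreeAll τ (t ++ w)) (R.agreeAll τ w))
        (imp (Policy.differsFirst L R τ w) (Policy.differsFirst L R τ (t ++ w))))) := by
  induction t with
  | nil =>
    refine ⟨h₁, h₂, hD.mono (hD.step [] (and (imp (var 0) (or (var 0) (var 1)))
      (and (imp (var 1) (var 1)) (imp (var 0) (var 0))))
      [Policy.differsFirst L R τ w, R.agreeAll τ w] .nil ?_ (by simp [eval]; tauto) (by decide))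
      (by simp)⟩
    simpa using ⟨h₁, h₂⟩
  | cons u t ih =>
    have h₁' : (Policy.differsFirst L R τ (t ++ w)).Within M V ∧ _ := Within.of_or h₁
    have h₁'' : _ ∧ _ := Within.of_and h₁'.2
    have h₂' : _ ∧ (R.agreeAll τ (t ++ w)).Within M V := Within.of_and h₂
    obtain ⟨hw₁, hw₂, h⟩ := ih h₁'.1 h₂'.2
    refine ⟨hw₁, hw₂, hD.mono (hD.step
      [and (imp (var 0) (or (var 1) (var 2))) (and (imp (var 3) (var 2)) (imp (var 1) (var 0)))]
      (and (imp (or (var 0) (and (var 4) (var 3))) (or (var 1) (var 2)))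
        (and (imp (and (var 5) (var 3)) (var 2)) (imp (var 1) (or (var 0) (and (var 4) (var 3))))))
      [Policy.differsFirst L R τ (t ++ w), Policy.differsFirst L R τ w, R.agreeAll τ w,
        R.agreeAll τ (t ++ w), neg (L.agree τ u), R.agree τ u] (.cons h .nil) (by simp [*])
      (by simp [eval]; tauto) (by decide)) (by simp)⟩

/-- Two policies that both agree with `τ` at `u` act alike there. -/
theorem same_of_agree (hD : CostDerivability (Within M V) D) {L R : Policy} (τ : Annotation) {u : ℕ}
    (hV : ∀ v ∈ [L.setVar u, L.valVar u, R.setVar u, R.valVar u], (var v).Within M V) :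
    D 1 (imp (and (L.agree τ u) (R.agree τ u)) (R.same L u)) := by
  have step (C : Form) (hs : ∀ v : ℕ → Prop, C.eval v) (hC : C.Small) :
      D 1 (C.subst (inst [var (L.setVar u), var (L.valVar u), var (R.setVar u),
        var (R.valVar u)])) :=
    hD.step [] C _ .nil (by simpa using hV) (fun v _ => hs v) ⟨by simp, by simp, hC⟩
  unfold Policy.agree Policy.same
  split
  · exact step (imp (and (and (var 0) (var 1)) (and (var 2) (var 3)))
      (and (iff (var 2) (var 0)) (imp (var 0) (iff (var 3) (var 1)))))
      (by simp [eval]; tauto) (by decide)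
  · exact step (imp (and (and (var 0) (neg (var 1))) (and (var 2) (neg (var 3))))
      (and (iff (var 2) (var 0)) (imp (var 0) (iff (var 3) (var 1)))))
      (by simp [eval]; tauto) (by decide)
  · exact step (imp (and (neg (var 0)) (neg (var 2)))
      (and (iff (var 2) (var 0)) (imp (var 0) (iff (var 3) (var 1)))))
      (by simp [eval]; tauto) (by decide)

end CostDerivability

/-! ### Quantifier prefixes and their expansion by extension variables -/

namespace QPrefix

theorem names_append (P₁ P₂ : QPrefix) : names (P₁ ++ P₂) = names P₁ ++ names P₂ :=
  List.map_append

theorem names_cons (q : Quant) (v : ℕ) (P : QPrefix) : names ((q, v) :: P) = v :: names P :=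
  List.map_cons

theorem universals_append (P₁ P₂ : QPrefix) :
    universals (P₁ ++ P₂) = universals P₁ ++ universals P₂ := by
  simp [universals]

theorem mem_universals {P : QPrefix} {u : ℕ} : u ∈ universals P ↔ (Quant.all, u) ∈ P := by
  simp [universals]

theorem mem_names_of_mem_universals {P : QPrefix} {u : ℕ} (h : u ∈ universals P) : u ∈ names P :=
  List.mem_map_of_mem (mem_universals.1 h)

theorem LeftOf.mem_names {P : QPrefix} {v w : ℕ} (h : LeftOf P v w) :
    v ∈ names P ∧ w ∈ names P := by
  obtain ⟨l₁, l₂, h, hv⟩ := h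
  simp [h, hv]

theorem eq_of_append_cons_eq {l₁ l₂ m₁ m₂ : List ℕ} {w : ℕ} (hl : (l₁ ++ w :: l₂).Nodup)
    (h : l₁ ++ w :: l₂ = m₁ ++ w :: m₂) : l₁ = m₁ := by
  have take_eq {n₁ n₂ : List ℕ} (hn : (n₁ ++ w :: n₂).Nodup) :
      (n₁ ++ w :: n₂).takeWhile (· ≠ w) = n₁ := by
    rw [List.takeWhile_append_of_pos]
    · simp
    · intro v hv
      have := (List.nodup_append.1 hn).2.2 v hv w (by simp)
      simpa using this
  rw [← take_eq hl, h, take_eq (h ▸ hl)]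

theorem leftOf_iff {P₁ P₂ : QPrefix} {q : Quant} {v w : ℕ}
    (hP : (names (P₁ ++ (q, w) :: P₂)).Nodup) :
    LeftOf (P₁ ++ (q, w) :: P₂) v w ↔ v ∈ names P₁ := by
  rw [names_append, names_cons] at hP
  constructor
  · rintro ⟨l₁, l₂, h, hv⟩
    rw [names_append, names_cons] at h
    exact eq_of_append_cons_eq hP h ▸ hv
  · exact fun h => ⟨_, _, by rw [names_append, names_cons], h⟩

theorem leftOf_iff_sublist {P : QPrefix} {v w : ℕ} : LeftOf P v w ↔ [v, w].Sublist (names P) := by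
  constructor
  · rintro ⟨l₁, l₂, h, hv⟩
    rw [h]
    exact (List.singleton_sublist.2 hv).append (List.singleton_sublist.2 (by simp))
  · intro h
    obtain ⟨r₁, r₂, h, hv, hw⟩ := List.cons_sublist_iff.1 h
    obtain ⟨s, t, rfl⟩ := List.append_of_mem (List.singleton_sublist.1 hw)
    exact ⟨r₁ ++ s, t, by rw [h]; simp, by simp [hv]⟩

theorem LeftOf.trans {P : QPrefix} (hP : (names P).Nodup) {v w z : ℕ} (h₁ : LeftOf P v w)
    (h₂ : LeftOf P w z) : LeftOf P v z := by
  obtain ⟨m₁, m₂, hm, hv⟩ := h₁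
  obtain ⟨l₁, l₂, hl, hw⟩ := h₂
  obtain ⟨s, t, rfl⟩ := List.append_of_mem hw
  rw [hl, List.append_assoc, List.cons_append] at hm hP
  obtain rfl := eq_of_append_cons_eq hP hm
  exact ⟨_, l₂, hl, by simp [hv]⟩

theorem universals_sublist_names (P : QPrefix) : (universals P).Sublist (names P) :=
  List.filter_sublist.map _

/-- The prefix `P` with the two variables of the policy `B` for a universal variable inserted
immediately left of this variable. -/
def expand (B : Policy) (P : QPrefix) : QPrefix :=
  P.flatMap fun q =>
    if q.1 = Quant.all then [(Quant.ex, B.setVar q.2), (Quant.ex, B.valVar q.2), q] else [q]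

theorem expand_append (B : Policy) (P₁ P₂ : QPrefix) :
    expand B (P₁ ++ P₂) = expand B P₁ ++ expand B P₂ :=
  List.flatMap_append

theorem expand_all_cons (B : Policy) (u : ℕ) (P : QPrefix) : expand B ((Quant.all, u) :: P) =
    (Quant.ex, B.setVar u) :: (Quant.ex, B.valVar u) :: (Quant.all, u) :: expand B P := by
  simp [expand]

theorem expand_ex_cons (B : Policy) (v : ℕ) (P : QPrefix) :
    expand B ((Quant.ex, v) :: P) = (Quant.ex, v) :: expand B P := by
  simp [expand]

theorem universals_expand (B : Policy) (P : QPrefix) :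
    universals (expand B P) = universals P := by
  induction P with
  | nil => rfl
  | cons q P ih =>
    obtain ⟨_ | _, v⟩ := q
    · rw [expand_ex_cons]; simpa [universals] using ih
    · rw [expand_all_cons]; simpa [universals] using ih

theorem names_sublist_expand (B : Policy) (P : QPrefix) :
    (names P).Sublist (names (expand B P)) := by
  induction P with
  | nil => exact List.Sublist.refl _
  | cons q P ih =>
    obtain ⟨_ | _, v⟩ := q
    · rw [expand_ex_cons]; exact ih.cons_cons v
    · rw [expand_all_cons]; exact ((ih.cons_cons v).cons _).cons _

theorem mem_names_expand {B : Policy} {P : QPrefix} {v : ℕ} : v ∈ names (expand B P) ↔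
    v ∈ names P ∨ ∃ u ∈ universals P, v = B.setVar u ∨ v = B.valVar u := by
  induction P with
  | nil => simp [expand, names, universals]
  | cons q P ih =>
    obtain ⟨_ | _, w⟩ := q
    · rw [expand_ex_cons, names_cons, names_cons, List.mem_cons, List.mem_cons, ih]
      simp [universals, or_assoc]
    · rw [expand_all_cons, names_cons, names_cons, names_cons, names_cons]
      simp only [List.mem_cons, ih]
      simp only [universals, decide_true, List.filter_cons_of_pos, List.map_cons, List.mem_cons,
        exists_eq_or_imp]
      grind

end QPrefix

/-- A policy whose variables are numbered from `m` on. -/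
def Policy.fresh (m : ℕ) : Policy := ⟨fun u => m + 2 * u, fun u => m + 2 * u + 1⟩

namespace QPrefix

variable {P : QPrefix} {m : ℕ}

theorem leftOf_expand_fresh (hm : ∀ v ∈ names P, v < m) {v w : ℕ} (hv : v ∈ names P)
    (hw : w ∈ names P) : LeftOf (expand (Policy.fresh m) P) v w ↔ LeftOf P v w := by
  have hfilter : (names (expand (Policy.fresh m) P)).filter (· < m) = names P := by
    clear hv hw
    induction P with
    | nil => rfl
    | cons q P ih =>
      obtain ⟨_ | _, z⟩ := q
      all_goals
        rw [names_cons] at hm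
        simp only [List.forall_mem_cons] at hm
        simp only [expand_ex_cons, expand_all_cons, names_cons, List.filter_cons, ih hm.2, hm.1]
        simp [Policy.fresh]
      exact decide_eq_false (by omega)
  rw [leftOf_iff_sublist, leftOf_iff_sublist]
  refine ⟨fun h => ?_, fun h => h.trans (names_sublist_expand _ _)⟩
  have := h.filter (fun z => decide (z < m))
  rwa [hfilter, List.filter_eq_self.2 (by simp [hm v hv, hm w hw])] at this

theorem respects_expand (B : Policy) (P : QPrefix) : B.Respects (expand B P) := by
  intro u hu
  rw [universals_expand] at hu
  obtain ⟨P₁, P₂, rfl⟩ := List.append_of_mem (mem_universals.1 hu)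
  have : names (expand B (P₁ ++ (Quant.all, u) :: P₂)) =
      (names (expand B P₁) ++ [B.setVar u, B.valVar u]) ++ u :: names (expand B P₂) := by
    simp [expand_append, expand_all_cons, names_append, names_cons]
  exact ⟨⟨_, _, this, by simp⟩, ⟨_, _, this, by simp⟩⟩

end QPrefix

/-- A derivation can be continued by definitions of the variables of a fresh policy, provided that
the defining formulas for `u` only use variables left of `u`. -/
theorem EFregeDerivation.exists_expand {F : FregeSystem} {P : QPrefix} {Γ : List Form} {m : ℕ}
    (hm : ∀ v ∈ QPrefix.names P, v < m) (hP : (QPrefix.names P).Nodup) {s t : ℕ → Form}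
    (hs : ∀ u ∈ QPrefix.universals P, ∀ v ∈ (s u).vars ∪ (t u).vars, P.LeftOf v u) {z : ℕ}
    (hz : ∀ u ∈ QPrefix.universals P, (s u).size + (t u).size + 4 ≤ z) {π₀ : List Form}
    (d : EFregeDerivation F P Γ P π₀) :
    ∃ π : List Form, EFregeDerivation F P Γ (QPrefix.expand (Policy.fresh m) P) (π ++ π₀) ∧
      (∀ u ∈ QPrefix.universals P, iff (var ((Policy.fresh m).setVar u)) (s u) ∈ π ∧
        iff (var ((Policy.fresh m).valVar u)) (t u) ∈ π) ∧
      derivationSize π ≤ (QPrefix.universals P).length * z := by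
  set B := Policy.fresh m with hB
  suffices key : ∀ P₁ P₂ : QPrefix, P = P₁ ++ P₂ → ∃ π : List Form,
      EFregeDerivation F P Γ (QPrefix.expand B P₁ ++ P₂) (π ++ π₀) ∧
      (∀ u ∈ QPrefix.universals P₁, iff (var (B.setVar u)) (s u) ∈ π ∧
        iff (var (B.valVar u)) (t u) ∈ π) ∧
      derivationSize π ≤ (QPrefix.universals P₁).length * z by
    simpa using key P [] (by simp)
  intro P₁
  induction P₁ using List.reverseRecOn with
  | nil =>
    rintro P₂ rfl
    exact ⟨[], d, by simp [QPrefix.universals], by simp [derivationSize]⟩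
  | append_singleton P₁ q ih =>
    intro P₂ hP₂
    obtain ⟨π, dπ, hπ, zπ⟩ := ih (q :: P₂) (by simpa using hP₂)
    obtain ⟨_ | _, u⟩ := q
    · refine ⟨π, ?_, ?_, ?_⟩
      · simpa [QPrefix.expand_append, QPrefix.expand] using dπ
      · simpa [QPrefix.universals] using hπ
      · simpa [QPrefix.universals] using zπ
    · have hP' : P = P₁ ++ (Quant.all, u) :: P₂ := by simpa using hP₂
      have hu : u ∈ QPrefix.universals P := QPrefix.mem_universals.2 (by simp [hP'])
      have hvars : ∀ v ∈ (s u).vars ∪ (t u).vars, v ∈ QPrefix.names P₁ := by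
        intro v hv
        have := hs u hu v hv
        rw [hP'] at this hP
        exact (QPrefix.leftOf_iff hP).1 this
      have hsub : ∀ v ∈ QPrefix.names P₁, v ∈ QPrefix.names (QPrefix.expand B P₁) :=
        fun v hv => (QPrefix.names_sublist_expand B P₁).subset hv
      have huP₁ : u ∉ QPrefix.universals P₁ := by
        intro h
        rw [hP', QPrefix.names_append, QPrefix.names_cons] at hP
        exact (List.nodup_append.1 hP).2.2 u (QPrefix.mem_names_of_mem_universals h) u (by simp) rfl
      have hnew : ∀ v, m + 2 * u ≤ v → v ≤ m + 2 * u + 1 →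
          v ∉ QPrefix.names (QPrefix.expand B P₁ ++ (Quant.all, u) :: P₂) := by
        intro v hv₁ hv₂ hmem
        rw [QPrefix.names_append, List.mem_append, QPrefix.mem_names_expand, or_right_comm,
          ← List.mem_append, ← QPrefix.names_append, ← hP'] at hmem
        rcases hmem with h | ⟨w, hw, h⟩
        · have := hm v h
          omega
        · simp only [hB, Policy.fresh] at h
          obtain rfl : w = u := by omega
          exact huP₁ hw
      have d₁ := dπ.ext (hnew (B.setVar u) le_rfl (by simp [hB, Policy.fresh]))
        (A := s u) fun w hw => hsub w (hvars w (by simp [hw]))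
      rw [show ∀ q : Quant × ℕ, QPrefix.expand B P₁ ++ q :: (Quant.all, u) :: P₂ =
        (QPrefix.expand B P₁ ++ [q]) ++ (Quant.all, u) :: P₂ by simp] at d₁
      have d₂ := d₁.ext (v := B.valVar u) (A := t u) ?_ fun w hw => ?_
      · refine ⟨iff (var (B.valVar u)) (t u) :: iff (var (B.setVar u)) (s u) :: π, ?_, ?_, ?_⟩
        · simpa [QPrefix.expand_append, QPrefix.expand] using d₂
        · intro w hw
          rw [QPrefix.universals_append, List.mem_append] at hw
          rcases hw with hw | hw
          · simp [hπ w hw]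
          · obtain rfl : w = u := by simpa [QPrefix.universals] using hw
            simp
        · have := hz u hu
          have hlen : (QPrefix.universals (P₁ ++ [(Quant.all, u)])).length =
            (QPrefix.universals P₁).length + 1 := by simp [QPrefix.universals]
          rw [derivationSize_cons, derivationSize_cons, hlen, add_mul, one_mul]
          simp only [size]
          omega
      · have := hnew (B.valVar u) (by simp [hB, Policy.fresh]) le_rfl
        simp only [QPrefix.names_append, QPrefix.names_cons, List.mem_append, List.mem_cons,
          not_or] at this ⊢
        refine ⟨⟨this.1, ?_, by simp [QPrefix.names]⟩, this.2⟩
        simp [hB, Policy.fresh]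
      · rw [QPrefix.names_append]
        exact List.mem_append_left _ (hsub w (hvars w (by simp [hw])))

/-! ### Sizes and variables of the formulas of a policy -/

namespace Form

theorem size_bigAnd (l : List Form) : (bigAnd l).size = (l.map fun A => A.size + 1).sum + 1 := by
  induction l with
  | nil => rfl
  | cons A l ih => simp only [bigAnd, size, ih, List.map_cons, List.sum_cons]; omega

theorem size_bigOr (l : List Form) : (bigOr l).size = (l.map fun A => A.size + 1).sum + 1 := by
  induction l with
  | nil => rfl
  | cons A l ih => simp only [bigOr, size, ih, List.map_cons, List.sum_cons]; omega

theorem length_le_size_bigAnd (l : List Form) : l.length ≤ (bigAnd l).size := by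
  induction l with
  | nil => simp
  | cons A l ih => simp only [bigAnd, size, List.length_cons]; omega

theorem length_le_size_bigOr (l : List Form) : l.length ≤ (bigOr l).size :=
  (length_le_size_bigAnd l).trans_eq (by rw [size_bigAnd, size_bigOr])

theorem vars_bigAnd {l : List Form} {p : ℕ → Prop} (h : ∀ A ∈ l, ∀ v ∈ A.vars, p v) :
    ∀ v ∈ (bigAnd l).vars, p v := by
  induction l with
  | nil => simp [bigAnd, vars]
  | cons A l ih =>
    intro v hv
    rcases Finset.mem_union.1 hv with hv | hv
    · exact h A (by simp) v hv
    · exact ih (fun B hB => h B (by simp [hB])) v hv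

theorem vars_bigOr {l : List Form} {p : ℕ → Prop} (h : ∀ A ∈ l, ∀ v ∈ A.vars, p v) :
    ∀ v ∈ (bigOr l).vars, p v := by
  induction l with
  | nil => simp [bigOr, vars]
  | cons A l ih =>
    intro v hv
    rcases Finset.mem_union.1 hv with hv | hv
    · exact h A (by simp) v hv
    · exact ih (fun B hB => h B (by simp [hB])) v hv

end Form

namespace Policy

variable {P P' : QPrefix}

theorem size_toForm (S : Policy) : (S.toForm P).size = (QPrefix.universals P).length * 6 + 1 := by
  simp [toForm, size_bigAnd, Function.comp_def, size]

theorem size_conLit_congr (B S : Policy)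
    (hP : QPrefix.universals P' = QPrefix.universals P) {l : AnnLit}
    (hl : ∀ u ∈ QPrefix.universals P, P'.LeftOf u l.x ↔ P.LeftOf u l.x) :
    (B.conLit P' l).size = (S.conLit P l).size := by
  have hann : (B.ann P' l.x l.τ).size = (S.ann P l.x l.τ).size := by
    unfold ann
    rw [size_bigAnd, size_bigAnd, List.map_flatMap, List.map_flatMap, hP]
    congr 2
    refine List.flatMap_congr fun u hu => ?_
    unfold annConj
    rcases l.τ u with _ | _ | _
    · by_cases h : P.LeftOf u l.x
      · simp [h, (hl u hu).2 h, size]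
      · simp [h, mt (hl u hu).1 h]
    · simp [size]
    · simp [size]
  unfold conLit
  simp only [size, hann]

theorem size_con_le (B L R : Policy) (hP : QPrefix.universals P' = QPrefix.universals P)
    {C₁ C₂ : AnnClause} {l₁ l₂ : AnnLit} (hl : ∀ l ∈ C₁ ++ C₂, ∀ u ∈ QPrefix.universals P,
      P'.LeftOf u l.x ↔ P.LeftOf u l.x) :
    (B.con P' (C₁ ++ C₂)).size ≤ (L.con P (C₁ ++ [l₁])).size + (R.con P (C₂ ++ [l₂])).size := by
  have h₁ : C₁.map (fun l => (B.conLit P' l).size + 1) =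
      C₁.map (fun l => (L.conLit P l).size + 1) :=
    List.map_congr_left fun l h => by rw [size_conLit_congr B L hP (hl l (by simp [h]))]
  have h₂ : C₂.map (fun l => (B.conLit P' l).size + 1) =
      C₂.map (fun l => (R.conLit P l).size + 1) :=
    List.map_congr_left fun l h => by rw [size_conLit_congr B R hP (hl l (by simp [h]))]
  simp only [con, size_bigOr, List.map_map, Function.comp_def, List.map_append, List.sum_append,
    h₁, h₂]
  omega

theorem vars_toForm {S : Policy} (hS : S.Respects P) :
    ∀ v ∈ (S.toForm P).vars, v ∈ QPrefix.names P := by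
  refine vars_bigAnd fun A hA => ?_
  obtain ⟨u, hu, rfl⟩ := List.mem_map.1 hA
  simp only [vars, Finset.mem_union, Finset.mem_singleton]
  rintro v (rfl | rfl | rfl)
  exacts [(hS u hu).1.mem_names.1, QPrefix.mem_names_of_mem_universals hu,
    (hS u hu).2.mem_names.1]

theorem vars_con {S : Policy} (hS : S.Respects P) {C : AnnClause}
    (hC : ∀ l ∈ C, l.x ∈ QPrefix.names P) :
    ∀ v ∈ (S.con P C).vars, v ∈ QPrefix.names P := by
  refine vars_bigOr fun A hA => ?_
  obtain ⟨l, hl, rfl⟩ := List.mem_map.1 hA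
  intro v hv
  rcases Finset.mem_union.1 hv with hv | hv
  · have : v = l.x := by split at hv <;> simpa [vars] using hv
    exact this ▸ hC l hl
  · refine vars_bigAnd (p := (· ∈ QPrefix.names P)) (fun A hA => ?_) v hv
    obtain ⟨u, hu, hA⟩ := List.mem_flatMap.1 hA
    have h₁ := (hS u hu).1.mem_names.1
    have h₂ := QPrefix.mem_names_of_mem_universals hu
    unfold annConj at hA
    split at hA <;> [skip; skip; split at hA] <;> simp at hA <;> subst hA <;>
      simp [vars, h₁, h₂]

theorem vars_claim {S : Policy} (hS : S.Respects P) {C : AnnClause}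
    (hC : ∀ l ∈ C, l.x ∈ QPrefix.names P) :
    ∀ v ∈ (S.claim P C).vars, v ∈ QPrefix.names P := by
  intro v hv
  rcases Finset.mem_union.1 hv with hv | hv
  exacts [vars_toForm hS v hv, vars_con hS hC v hv]

/-- The formula that decides which of the policies `L` and `R` is followed at `u`, where `a` are the
universal variables left of `x` in the order of the prefix: true stands for `L`. Left of `x` it only
looks at the variables up to `u`. -/
def select (L R : Policy) (τ : Annotation) (x : ℕ) (a : List ℕ) (u : ℕ) : Form :=
  if u ∈ a then differsFirst L R τ (u :: (a.takeWhile (· ≠ u)).reverse)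
  else choice L R τ x a.reverse

theorem select_eq_differsFirst {L R : Policy} {τ : Annotation} {x u : ℕ} {a₁ a₂ : List ℕ}
    (ha : (a₁ ++ u :: a₂).Nodup) :
    select L R τ x (a₁ ++ u :: a₂) u = differsFirst L R τ (u :: a₁.reverse) := by
  rw [select, if_pos (by simp), List.takeWhile_append_of_pos]
  · simp
  · intro v hv
    have := (List.nodup_append.1 ha).2.2 v hv u (by simp)
    simpa using this

end Policy

/-! ### The policy that follows the selected policy -/

namespace CostDerivability

variable {M : ℕ} {V : List ℕ} {D : ℕ → Form → Prop}

/-- If the final choice is `L`, then `L` is selected at `u`, unless both policies still agree with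
the annotation at `u`, and hence with each other. -/
theorem select_of_choice (hD : CostDerivability (Within M V) D) {L R : Policy} {τ : Annotation}
    {x u : ℕ} {a : List ℕ} (ha : a.Nodup) {G : Form} (hG : G.Within M V)
    (hC : (Policy.choice L R τ x a.reverse).Within M V) (hE : (R.same L u).Within M V)
    (hV : ∀ v ∈ [L.setVar u, L.valVar u, R.setVar u, R.valVar u], (var v).Within M V) {n : ℕ}
    (hn : a.length ≤ n) :
    D (n + 3) (imp (and G (Policy.choice L R τ x a.reverse))
      (or (Policy.select L R τ x a u) (R.same L u))) := by
  by_cases hu : u ∈ a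
  · obtain ⟨a₁, a₂, rfl⟩ := List.append_of_mem hu
    rw [Policy.select_eq_differsFirst ha]
    have hrev : (a₁ ++ u :: a₂).reverse = a₂.reverse ++ (u :: a₁.reverse) := by simp
    rw [hrev] at hC ⊢
    have hC₁ : _ ∧ _ := Within.of_or hC
    have hC₂ : _ ∧ _ := Within.of_and hC₁.2
    obtain ⟨hw₁, hw₂, h⟩ := hD.differsFirst_append hC₁.1 hC₂.1
    have hw₁' : _ ∧ _ := Within.of_or hw₁
    have hw₂' : _ ∧ _ := Within.of_and hw₂
    have hL : (L.agree τ u).Within M V := by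
      have := (Within.of_and hw₁'.2).1
      simp only [Within, size, vars] at this ⊢
      exact ⟨by omega, this.2⟩
    refine hD.mono (hD.step
      [and (imp (var 0) (or (or (var 1) (and (neg (var 2)) (var 3))) (and (var 4) (var 3))))
        (and (imp (var 5) (and (var 4) (var 3)))
          (imp (or (var 1) (and (neg (var 2)) (var 3))) (var 0))),
        imp (and (var 2) (var 4)) (var 6)]
      (imp (and (var 7) (or (var 0) (and (var 5) (var 8))))
        (or (or (var 1) (and (neg (var 2)) (var 3))) (var 6)))
      [_, Policy.differsFirst L R τ a₁.reverse, L.agree τ u, R.agreeAll τ a₁.reverse,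
        R.agree τ u, _, R.same L u, G, var x]
      (.cons h (.cons (hD.same_of_agree τ hV) .nil)) (by simp [*]) (by simp [eval]; grind)
      (by decide)) ?_
    simp only [List.length_append, List.length_cons, List.length_reverse, List.sum_cons,
      List.sum_nil] at hn ⊢
    omega
  · rw [Policy.select, if_neg hu]
    exact hD.mono (hD.step [] (imp (and (var 0) (var 1)) (or (var 1) (var 2)))
      [G, Policy.choice L R τ x a.reverse, R.same L u] .nil (by simp [*]) (by simp [eval]; tauto)
      (by decide)) (by simp)

/-- If the final choice is `R`, then `L` is never selected. -/
theorem not_select_of_not_choice (hD : CostDerivability (Within M V) D) {L R : Policy}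
    {τ : Annotation} {x u : ℕ} {a : List ℕ} (ha : a.Nodup) {G : Form} (hG : G.Within M V)
    (hC : (Policy.choice L R τ x a.reverse).Within M V) {n : ℕ} (hn : a.length ≤ n) :
    D (n + 3) (imp (and G (neg (Policy.choice L R τ x a.reverse)))
      (neg (Policy.select L R τ x a u))) := by
  by_cases hu : u ∈ a
  · obtain ⟨a₁, a₂, rfl⟩ := List.append_of_mem hu
    rw [Policy.select_eq_differsFirst ha]
    have hrev : (a₁ ++ u :: a₂).reverse = a₂.reverse ++ (u :: a₁.reverse) := by simp
    rw [hrev] at hC ⊢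
    have hC₁ : _ ∧ _ := Within.of_or hC
    have hC₂ : _ ∧ _ := Within.of_and hC₁.2
    obtain ⟨hw₁, hw₂, h⟩ := hD.differsFirst_append hC₁.1 hC₂.1
    refine hD.mono (hD.step
      [and (imp (var 0) (or (var 1) (var 2))) (and (imp (var 3) (var 2)) (imp (var 1) (var 0)))]
      (imp (and (var 4) (neg (or (var 0) (and (var 3) (var 5))))) (neg (var 1)))
      [_, Policy.differsFirst L R τ (u :: a₁.reverse), R.agreeAll τ (u :: a₁.reverse), _, G, var x]
      (.cons h .nil) (by simp [*]) (by simp [eval]; tauto) (by decide)) ?_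
    simp only [List.length_append, List.length_cons, List.length_reverse, List.sum_cons,
      List.sum_nil] at hn ⊢
    omega
  · rw [Policy.select, if_neg hu]
    exact hD.mono (hD.step [] (imp (and (var 0) (neg (var 1))) (neg (var 1)))
      [G, Policy.choice L R τ x a.reverse] .nil (by simp [*]) (by simp [eval])
      (by decide)) (by simp)

theorem same_left_of_select (hD : CostDerivability (Within M V) D) {B L R : Policy} {u : ℕ}
    {H s : Form} (hH : H.Within M V) (hs : s.Within M V)
    (hV : ∀ v ∈ [B.setVar u, B.valVar u, L.setVar u, L.valVar u, R.setVar u, R.valVar u],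
      (var v).Within M V) {k : ℕ}
    (hset : D 0 (iff (var (B.setVar u)) (ite s (var (L.setVar u)) (var (R.setVar u)))))
    (hval : D 0 (iff (var (B.valVar u)) (ite s (var (L.valVar u)) (var (R.valVar u)))))
    (h : D k (imp H (or s (R.same L u)))) : D (k + 1) (imp H (B.same L u)) := by
  simp only [List.forall_mem_cons] at hV
  exact hD.mono (hD.step
    [iff (var 2) (or (and (var 1) (var 4)) (and (neg (var 1)) (var 6))),
      iff (var 3) (or (and (var 1) (var 5)) (and (neg (var 1)) (var 7))),
      imp (var 0) (or (var 1) (and (iff (var 6) (var 4)) (imp (var 4) (iff (var 7) (var 5)))))]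
    (imp (var 0) (and (iff (var 2) (var 4)) (imp (var 4) (iff (var 3) (var 5)))))
    [H, s, var (B.setVar u), var (B.valVar u), var (L.setVar u), var (L.valVar u),
      var (R.setVar u), var (R.valVar u)] (.cons hset (.cons hval (.cons h .nil))) (by simp [*])
    (by simp [eval]; grind) (by decide)) (by simp)

theorem same_right_of_not_select (hD : CostDerivability (Within M V) D) {B L R : Policy} {u : ℕ}
    {H s : Form} (hH : H.Within M V) (hs : s.Within M V)
    (hV : ∀ v ∈ [B.setVar u, B.valVar u, L.setVar u, L.valVar u, R.setVar u, R.valVar u],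
      (var v).Within M V) {k : ℕ}
    (hset : D 0 (iff (var (B.setVar u)) (ite s (var (L.setVar u)) (var (R.setVar u)))))
    (hval : D 0 (iff (var (B.valVar u)) (ite s (var (L.valVar u)) (var (R.valVar u)))))
    (h : D k (imp H (neg s))) : D (k + 1) (imp H (B.same R u)) := by
  simp only [List.forall_mem_cons] at hV
  exact hD.mono (hD.step
    [iff (var 2) (or (and (var 1) (var 4)) (and (neg (var 1)) (var 6))),
      iff (var 3) (or (and (var 1) (var 5)) (and (neg (var 1)) (var 7))),
      imp (var 0) (neg (var 1))]
    (imp (var 0) (and (iff (var 2) (var 6)) (imp (var 6) (iff (var 3) (var 7)))))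
    [H, s, var (B.setVar u), var (B.valVar u), var (L.setVar u), var (L.valVar u),
      var (R.setVar u), var (R.valVar u)] (.cons hset (.cons hval (.cons h .nil))) (by simp [*])
    (by simp [eval]; grind) (by decide)) (by simp)

/-- If the final choice is `L`, then `L` differs from `τ` left of `x`, or `x` is true; so the literal
`¬x^τ` is not the true one in the clause of `L`. -/
theorem not_conLit_of_choice (hD : CostDerivability (Within M V) D) {P : QPrefix} {L R : Policy}
    {x : ℕ} {τ : Annotation} {r : List ℕ} {G : Form} (hG : G.Within M V)
    (hL : (L.toForm P).Within M V) (hA : (L.ann P x τ).Within M V)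
    (hLA : (and (L.toForm P) (L.ann P x τ)).Within M V)
    (hC : (Policy.choice L R τ x r).Within M V) {n : ℕ}
    (hn : (QPrefix.universals P).length ≤ n) (hrn : r.length ≤ n)
    (hr : ∀ u ∈ r, u ∈ QPrefix.universals P ∧ P.LeftOf u x)
    (hV : ∀ u ∈ QPrefix.universals P, ∀ v ∈ [u, L.setVar u, L.valVar u], (var v).Within M V) :
    D (n * (2 * n + 2) + 2) (imp (and G (Policy.choice L R τ x r))
      (imp (L.toForm P) (neg (L.conLit P ⟨x, false, τ⟩)))) := by
  have hC₁ : _ ∧ _ := Within.of_or hC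
  have hC₂ : _ ∧ _ := Within.of_and hC₁.2
  have h := hD.not_differsFirst_of_agree hLA
    (fun u hu => hD.agree_of_ann hL hA hn (hr u hu).1 (hr u hu).2 (hV u (hr u hu).1)) hC₁.1
  exact hD.mono (hD.step [imp (and (var 0) (var 1)) (neg (var 2))]
    (imp (and (var 3) (or (var 2) (and (var 4) (var 5))))
      (imp (var 0) (neg (and (neg (var 5)) (var 1)))))
    [L.toForm P, L.ann P x τ, Policy.differsFirst L R τ r, G, R.agreeAll τ r, var x]
    (.cons (hD.mono h (Nat.add_le_add_right (Nat.mul_le_mul_right _ hrn) 1)) .nil)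
    (by simp [*]) (by simp [eval]; tauto) (by decide)) (by simp)

/-- If the final choice is `R`, then `R` differs from `τ` left of `x`, or `x` is false; so the
literal `x^τ` is not the true one in the clause of `R`. -/
theorem not_conLit_of_not_choice (hD : CostDerivability (Within M V) D) {P : QPrefix}
    {L R : Policy} {x : ℕ} {τ : Annotation} {r : List ℕ} {G : Form} (hG : G.Within M V)
    (hR : (R.toForm P).Within M V) (hA : (R.ann P x τ).Within M V)
    (hRA : (and (R.toForm P) (R.ann P x τ)).Within M V)
    (hC : (Policy.choice L R τ x r).Within M V) {n : ℕ}
    (hn : (QPrefix.universals P).length ≤ n) (hrn : r.length ≤ n)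
    (hr : ∀ u ∈ r, u ∈ QPrefix.universals P ∧ P.LeftOf u x)
    (hV : ∀ u ∈ QPrefix.universals P, ∀ v ∈ [u, R.setVar u, R.valVar u], (var v).Within M V) :
    D (n * (2 * n + 2) + 2) (imp (and G (neg (Policy.choice L R τ x r)))
      (imp (R.toForm P) (neg (R.conLit P ⟨x, true, τ⟩)))) := by
  have hC₁ : _ ∧ _ := Within.of_or hC
  have hC₂ : _ ∧ _ := Within.of_and hC₁.2
  have h := hD.agreeAll_of_agree hRA
    (fun u hu => hD.agree_of_ann hR hA hn (hr u hu).1 (hr u hu).2 (hV u (hr u hu).1)) hC₂.1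
  exact hD.mono (hD.step [imp (and (var 0) (var 1)) (var 4)]
    (imp (and (var 3) (neg (or (var 2) (and (var 4) (var 5)))))
      (imp (var 0) (neg (and (var 5) (var 1)))))
    [R.toForm P, R.ann P x τ, Policy.differsFirst L R τ r, G, R.agreeAll τ r, var x]
    (.cons (hD.mono h (Nat.add_le_add_right (Nat.mul_le_mul_right _ hrn) 1)) .nil)
    (by simp [*]) (by simp [eval]; tauto) (by decide)) (by simp)

end CostDerivability

/-! ### Resolution of two policies -/

/-- A bound for the size of the formulas that choose between two policies over at most `n` universal
variables. -/
def choiceBound (n : ℕ) : ℕ := n * (5 * n + 8) + 5 * n + 5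

theorem Policy.size_select_le (L R : Policy) (τ : Annotation) (x : ℕ) {a : List ℕ} {n : ℕ}
    (hn : a.length ≤ n) (u : ℕ) : (select L R τ x a u).size ≤ choiceBound n := by
  have h := (size_choice_le L R τ x (r := a.reverse) (n := n) (by simpa using hn))
  unfold select
  split
  · rename_i hu
    obtain ⟨a₁, a₂, rfl⟩ := List.append_of_mem hu
    have htw : (u :: ((a₁ ++ u :: a₂).takeWhile (· ≠ u)).reverse).length ≤ n := by
      refine le_trans ?_ hn
      have := (List.takeWhile_sublist (fun v => decide (v ≠ u)) (l := a₁ ++ u :: a₂))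
      rw [List.length_cons, List.length_reverse, Nat.succ_le_iff]
      -- The part of the list before `u` does not contain `u`, and so is shorter than the list.
      refine lt_of_le_of_ne this.length_le fun h => ?_
      have hmem : u ∈ (a₁ ++ u :: a₂).takeWhile (fun v => decide (v ≠ u)) := by
        rw [this.eq_of_length h]; simp
      simpa using List.mem_takeWhile_imp hmem
    have h₂ := size_differsFirst_le L R τ htw
    have h₃ := Nat.mul_le_mul_right (5 * n + 8) htw
    unfold choiceBound
    omega
  · exact h

/-- The selection at `u` is determined left of `u`, so that it may define variables inserted there.
-/
theorem Policy.vars_select {L R : Policy} {τ : Annotation} {x u v : ℕ} {Q Q' : QPrefix}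
    (hP : (QPrefix.names (Q ++ (Quant.ex, x) :: Q')).Nodup)
    (hL : L.Respects (Q ++ (Quant.ex, x) :: Q')) (hR : R.Respects (Q ++ (Quant.ex, x) :: Q'))
    (hu : u ∈ QPrefix.universals (Q ++ (Quant.ex, x) :: Q'))
    (hv : v ∈ (select L R τ x (QPrefix.universals Q) u).vars) :
    (Q ++ (Quant.ex, x) :: Q').LeftOf v u := by
  have hPx (w : ℕ) (hw : w ∈ QPrefix.universals Q) : (Q ++ (Quant.ex, x) :: Q').LeftOf w x :=
    (QPrefix.leftOf_iff hP).2 (QPrefix.mem_names_of_mem_universals hw)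
  have hw_of {w : ℕ} (hw : w ∈ QPrefix.universals (Q ++ (Quant.ex, x) :: Q'))
      (h : v = L.setVar w ∨ v = L.valVar w ∨ v = R.setVar w ∨ v = R.valVar w) :
      (Q ++ (Quant.ex, x) :: Q').LeftOf v w := by
    have h₁ := hL w hw
    have h₂ := hR w hw
    rcases h with rfl | rfl | rfl | rfl
    exacts [h₁.1, h₁.2, h₂.1, h₂.2]
  have hsub (w : ℕ) (hw : w ∈ QPrefix.universals Q) :
      w ∈ QPrefix.universals (Q ++ (Quant.ex, x) :: Q') := by
    rw [QPrefix.universals_append]; exact List.mem_append_left _ hw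
  by_cases hua : u ∈ QPrefix.universals Q
  · obtain ⟨a₁, a₂, ha⟩ := List.append_of_mem hua
    have hnd : (a₁ ++ u :: a₂).Nodup := by
      rw [QPrefix.names_append] at hP
      exact ha ▸ (List.nodup_append.1 hP).1.sublist (QPrefix.universals_sublist_names Q)
    rw [ha, select_eq_differsFirst hnd] at hv
    obtain ⟨w, hw, h⟩ := vars_differsFirst hv
    rcases List.mem_cons.1 hw with rfl | hw
    · exact hw_of hu h
    · have hw' : w ∈ a₁ := by simpa using hw
      refine (hw_of (hsub w (by simp [ha, hw'])) h).trans hP (QPrefix.leftOf_iff_sublist.2 ?_)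
      have h₁ : [w, u].Sublist (QPrefix.universals Q) := by
        rw [ha]
        exact (List.singleton_sublist.2 hw').append (List.singleton_sublist.2 (by simp))
      rw [QPrefix.names_append]
      exact (h₁.trans (QPrefix.universals_sublist_names Q)).trans (List.sublist_append_left _ _)
  · have hxu : (Q ++ (Quant.ex, x) :: Q').LeftOf x u := by
      have hu' : u ∈ QPrefix.names Q' := by
        rw [QPrefix.universals_append, List.mem_append] at hu
        refine QPrefix.mem_names_of_mem_universals ?_
        simpa [QPrefix.universals] using hu.resolve_left hua
      rw [QPrefix.leftOf_iff_sublist, QPrefix.names_append, QPrefix.names_cons]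
      exact ((List.singleton_sublist.2 hu').cons_cons x).trans (List.sublist_append_right _ _)
    rw [select, if_neg hua] at hv
    rcases vars_choice hv with ⟨w, hw, h⟩ | rfl
    · have hw' : w ∈ QPrefix.universals Q := by simpa using hw
      exact ((hw_of (hsub w hw') h).trans hP (hPx w hw')).trans hP hxu
    · exact hxu

/-- A bound for the size of the formulas by which the rules are instantiated. -/
def sizeBound (n : ℕ) : ℕ := choiceBound n + n + 20

/-- A bound for the number of steps from the definitions of the new policy to its claim. -/
def stepBound (n : ℕ) : ℕ := 2 * CostDerivability.transferCost n (n * (2 * n + 2) + n + 6) + 1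

set_option maxHeartbeats 400000 in
/-- The resolvent: from the claims of `L` and `R` and the definitions of a policy `B` that follows
`L` or `R` as `Policy.select` says, the claim of `B` is derivable. The proof distinguishes the two
values of the final choice `Policy.choice`; in either case `B` acts like one of the two policies
throughout, and `con_of_same` applies. -/
theorem CostDerivability.claim_resolvent {V : List ℕ} {D : ℕ → Form → Prop} {N : ℕ}
    (hD : CostDerivability (Within (sizeBound N) V) D) {Q Q' P' : QPrefix} {x : ℕ}
    (hP : (QPrefix.names (Q ++ (Quant.ex, x) :: Q')).Nodup)
    (hP' : QPrefix.universals P' = QPrefix.universals (Q ++ (Quant.ex, x) :: Q'))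
    {B L R : Policy} {C₁ C₂ : AnnClause} {τ : Annotation}
    (hV : QPrefix.names P' ⊆ V) (hPV : QPrefix.names (Q ++ (Quant.ex, x) :: Q') ⊆ V)
    (hB : B.Respects P') (hL : L.Respects (Q ++ (Quant.ex, x) :: Q'))
    (hR : R.Respects (Q ++ (Quant.ex, x) :: Q'))
    (hC : ∀ l ∈ C₁ ++ C₂, l.x ∈ QPrefix.names (Q ++ (Quant.ex, x) :: Q') ∧
      l.x ∈ QPrefix.names P' ∧ ∀ u ∈ QPrefix.universals (Q ++ (Quant.ex, x) :: Q'),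
        P'.LeftOf u l.x ↔ (Q ++ (Quant.ex, x) :: Q').LeftOf u l.x)
    (hN : (L.claim (Q ++ (Quant.ex, x) :: Q') (C₁ ++ [⟨x, false, τ⟩])).size +
      (R.claim (Q ++ (Quant.ex, x) :: Q') (C₂ ++ [⟨x, true, τ⟩])).size ≤ N)
    (hpL : D 0 (L.claim (Q ++ (Quant.ex, x) :: Q') (C₁ ++ [⟨x, false, τ⟩])))
    (hpR : D 0 (R.claim (Q ++ (Quant.ex, x) :: Q') (C₂ ++ [⟨x, true, τ⟩])))
    (hset : ∀ u ∈ QPrefix.universals (Q ++ (Quant.ex, x) :: Q'),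
      D 0 (iff (var (B.setVar u)) (ite (Policy.select L R τ x (QPrefix.universals Q) u)
        (var (L.setVar u)) (var (R.setVar u)))) ∧
      D 0 (iff (var (B.valVar u)) (ite (Policy.select L R τ x (QPrefix.universals Q) u)
        (var (L.valVar u)) (var (R.valVar u))))) :
    (B.claim P' (C₁ ++ C₂)).Within (sizeBound N) V ∧
      D (stepBound N) (B.claim P' (C₁ ++ C₂)) := by
  set P : QPrefix := Q ++ (Quant.ex, x) :: Q' with hPdef
  have hxP : x ∈ QPrefix.names P := by simp [hPdef, QPrefix.names]
  have hx₁ : ∀ l ∈ C₁ ++ [(⟨x, false, τ⟩ : AnnLit)], l.x ∈ QPrefix.names P := by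
    simp only [List.mem_append, List.mem_singleton]
    rintro l (h | rfl)
    exacts [(hC l (by simp [h])).1, hxP]
  have hx₂ : ∀ l ∈ C₂ ++ [(⟨x, true, τ⟩ : AnnLit)], l.x ∈ QPrefix.names P := by
    simp only [List.mem_append, List.mem_singleton]
    rintro l (h | rfl)
    exacts [(hC l (by simp [h])).1, hxP]
  have hsB := Policy.size_con_le B L R hP' (l₁ := ⟨x, false, τ⟩) (l₂ := ⟨x, true, τ⟩)
    fun l hl => (hC l hl).2.2
  have htL := L.size_toForm (P := P)
  have htR := R.size_toForm (P := P)
  have htB := B.size_toForm (P := P')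
  rw [hP'] at htB
  have hlC₁ := length_le_size_bigOr ((C₁ ++ [(⟨x, false, τ⟩ : AnnLit)]).map (L.conLit P))
  have hlC₂ := length_le_size_bigOr ((C₂ ++ [(⟨x, true, τ⟩ : AnnLit)]).map (R.conLit P))
  change _ ≤ (L.con P _).size at hlC₁
  change _ ≤ (R.con P _).size at hlC₂
  simp only [List.length_map] at hlC₁ hlC₂
  simp only [Policy.claim, size] at hN
  have hn : (QPrefix.universals P).length ≤ N := by omega
  have ha : (QPrefix.universals Q).length ≤ N := by
    refine le_trans ?_ hn
    rw [hPdef, QPrefix.universals_append, List.length_append]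
    omega
  have hlen : (C₁ ++ C₂).length ≤ N := by
    simp only [List.length_append, List.length_cons] at hlC₁ hlC₂ ⊢
    omega
  have hand : (QPrefix.universals Q).Nodup := by
    rw [hPdef, QPrefix.names_append] at hP
    exact (List.nodup_append.1 hP).1.sublist (QPrefix.universals_sublist_names Q)
  -- The formulas by which the rules are instantiated.
  have wL : (L.toForm P).Within (sizeBound N) V :=
    ⟨by unfold sizeBound; omega, fun v hv => hPV (Policy.vars_toForm hL v hv)⟩
  have wR : (R.toForm P).Within (sizeBound N) V :=
    ⟨by unfold sizeBound; omega, fun v hv => hPV (Policy.vars_toForm hR v hv)⟩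
  have wB : (B.toForm P').Within (sizeBound N) V :=
    ⟨by unfold sizeBound; omega, fun v hv => hV (Policy.vars_toForm hB v hv)⟩
  have wLC : (L.con P (C₁ ++ [⟨x, false, τ⟩])).Within (sizeBound N) V :=
    ⟨by unfold sizeBound; omega, fun v hv => hPV (Policy.vars_con hL hx₁ v hv)⟩
  have wRC : (R.con P (C₂ ++ [⟨x, true, τ⟩])).Within (sizeBound N) V :=
    ⟨by unfold sizeBound; omega, fun v hv => hPV (Policy.vars_con hR hx₂ v hv)⟩
  have wBC : (B.con P' (C₁ ++ C₂)).Within (sizeBound N) V :=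
    ⟨by unfold sizeBound; omega,
      fun v hv => hV (Policy.vars_con hB (fun l hl => (hC l hl).2.1) v hv)⟩
  have wBcl : (B.claim P' (C₁ ++ C₂)).Within (sizeBound N) V := by
    refine ⟨by simp only [Policy.claim, size]; unfold sizeBound; omega, fun v hv => ?_⟩
    exact hV (Policy.vars_claim hB (fun l hl => (hC l hl).2.1) v hv)
  have wvar : ∀ v ∈ V, (var v).Within (sizeBound N) V := fun v hv =>
    ⟨by simp only [size]; unfold sizeBound; omega, by simpa [vars] using hv⟩
  have hmem (u : ℕ) (hu : u ∈ QPrefix.universals P) : ∀ v ∈ [u, B.setVar u, B.valVar u,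
      L.setVar u, L.valVar u, R.setVar u, R.valVar u], v ∈ V := by
    have h₁ := hB u (hP' ▸ hu)
    have h₂ := hL u hu
    have h₃ := hR u hu
    simp [hPV (QPrefix.mem_names_of_mem_universals hu), hV h₁.1.mem_names.1, hV h₁.2.mem_names.1,
      hPV h₂.1.mem_names.1, hPV h₂.2.mem_names.1, hPV h₃.1.mem_names.1, hPV h₃.2.mem_names.1]
  have hvars {u : ℕ} (hu : u ∈ QPrefix.universals P) {l : List ℕ} (hl : l ⊆ [u, B.setVar u,
      B.valVar u, L.setVar u, L.valVar u, R.setVar u, R.valVar u]) :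
      ∀ v ∈ l, (var v).Within (sizeBound N) V :=
    fun v hv => wvar v (hmem u hu v (hl hv))
  have hr : ∀ u ∈ (QPrefix.universals Q).reverse, u ∈ QPrefix.universals P ∧ P.LeftOf u x := by
    intro u hu
    rw [List.mem_reverse] at hu
    refine ⟨?_, (QPrefix.leftOf_iff hP).2 (QPrefix.mem_names_of_mem_universals hu)⟩
    rw [hPdef, QPrefix.universals_append]
    exact List.mem_append_left _ hu
  have hchoice := Policy.size_choice_le L R τ x (r := (QPrefix.universals Q).reverse) (n := N)
    (by simpa using ha)
  have hchoiceV : ∀ v ∈ (Policy.choice L R τ x (QPrefix.universals Q).reverse).vars, v ∈ V := by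
    intro v hv
    rcases Policy.vars_choice hv with ⟨u, hu, h⟩ | rfl
    · have := hmem u (hr u hu).1
      rcases h with rfl | rfl | rfl | rfl <;> exact this _ (by simp)
    · exact hPV hxP
  have wch : (Policy.choice L R τ x (QPrefix.universals Q).reverse).Within (sizeBound N) V :=
    ⟨by unfold sizeBound choiceBound; omega, hchoiceV⟩
  have wH₁ : (and (B.toForm P') (Policy.choice L R τ x (QPrefix.universals Q).reverse)).Within
      (sizeBound N) V := by
    refine ⟨by simp only [size]; unfold sizeBound choiceBound; omega, fun v hv => ?_⟩
    rcases Finset.mem_union.1 hv with hv | hv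
    exacts [wB.2 v hv, hchoiceV v hv]
  have wH₂ : (and (B.toForm P') (neg (Policy.choice L R τ x
      (QPrefix.universals Q).reverse))).Within (sizeBound N) V := by
    refine ⟨by simp only [size]; unfold sizeBound choiceBound; omega, fun v hv => ?_⟩
    rcases Finset.mem_union.1 hv with hv | hv
    exacts [wB.2 v hv, hchoiceV v hv]
  have wsel (u : ℕ) (hu : u ∈ QPrefix.universals P) :
      (Policy.select L R τ x (QPrefix.universals Q) u).Within (sizeBound N) V :=
    ⟨(Policy.size_select_le L R τ x ha u).trans (by unfold sizeBound; omega),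
      fun v hv => hPV (Policy.vars_select hP hL hR hu hv).mem_names.1⟩
  have wsame (u : ℕ) (hu : u ∈ QPrefix.universals P) : (R.same L u).Within (sizeBound N) V := by
    have := hmem u hu
    refine ⟨by simp only [Policy.same, size]; unfold sizeBound; omega, ?_⟩
    simp only [Policy.same, vars, Finset.mem_union, Finset.mem_singleton]
    rintro v ((rfl | rfl) | rfl | rfl | rfl) <;> exact this _ (by simp)
  have wLl : (L.conLit P ⟨x, false, τ⟩).Within (sizeBound N) V :=
    wLC.of_mem_bigOr (List.mem_map_of_mem (by simp))
  have wRl : (R.conLit P ⟨x, true, τ⟩).Within (sizeBound N) V :=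
    wRC.of_mem_bigOr (List.mem_map_of_mem (by simp))
  have wLann : _ ∧ (L.ann P x τ).Within (sizeBound N) V := Within.of_and wLl
  have wRann : _ ∧ (R.ann P x τ).Within (sizeBound N) V := Within.of_and wRl
  have wLA : (and (L.toForm P) (L.ann P x τ)).Within (sizeBound N) V := by
    have h : (L.conLit P ⟨x, false, τ⟩).Within (L.con P (C₁ ++ [⟨x, false, τ⟩])).size V :=
      Within.of_mem_bigOr ⟨le_rfl, wLC.2⟩ (List.mem_map_of_mem (by simp))
    have h' : _ ∧ (L.ann P x τ).Within _ V := Within.of_and h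
    refine ⟨?_, fun v hv => (Finset.mem_union.1 hv).elim (wL.2 v) (wLann.2.2 v)⟩
    have := h'.2.1
    simp only [size]
    unfold sizeBound
    omega
  have wRA : (and (R.toForm P) (R.ann P x τ)).Within (sizeBound N) V := by
    have h : (R.conLit P ⟨x, true, τ⟩).Within (R.con P (C₂ ++ [⟨x, true, τ⟩])).size V :=
      Within.of_mem_bigOr ⟨le_rfl, wRC.2⟩ (List.mem_map_of_mem (by simp))
    have h' : _ ∧ (R.ann P x τ).Within _ V := Within.of_and h
    refine ⟨?_, fun v hv => (Finset.mem_union.1 hv).elim (wR.2 v) (wRann.2.2 v)⟩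
    have := h'.2.1
    simp only [size]
    unfold sizeBound
    omega
  -- The two cases of the final choice.
  set k := N * (2 * N + 2) + N + 6 with hk
  have hleft : D (transferCost N k) (imp (and (B.toForm P')
      (Policy.choice L R τ x (QPrefix.universals Q).reverse)) (B.con P' (C₁ ++ C₂))) := by
    refine hD.con_of_same hP' wH₁ (fun u hu => ?_) (fun l hl => (hC l (by simp [hl])).2.2)
      (List.subset_append_left _ _) wB wL wBC wLC (fun u hu => hvars hu (by simp)) hn
      (by omega) hlen ?_ (hD.mono hpL (Nat.zero_le _))
      (hD.mono (hD.not_conLit_of_choice wB wL wLann.2 wLA wch hn (by simpa using ha) hr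
        fun u hu => hvars hu (by simp)) (by omega))
    · refine hD.mono (hD.same_left_of_select wH₁ (wsel u hu) (hvars hu (by simp))
        (hset u hu).1 (hset u hu).2 (hD.select_of_choice hand wB wch (wsame u hu)
          (hvars hu (by simp)) ha)) (by omega)
    · exact hD.mono (hD.step [] (imp (and (var 0) (var 1)) (var 0))
        [B.toForm P', Policy.choice L R τ x (QPrefix.universals Q).reverse] .nil
        (by simpa using ⟨wB, wch⟩) (by simp only [eval]; exact fun _ _ h => h.1) (by decide))
        (by simp [hk])
  have hright : D (transferCost N k) (imp (and (B.toForm P')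
      (neg (Policy.choice L R τ x (QPrefix.universals Q).reverse))) (B.con P' (C₁ ++ C₂))) := by
    refine hD.con_of_same hP' wH₂ (fun u hu => ?_) (fun l hl => (hC l (by simp [hl])).2.2)
      (List.subset_append_right _ _) wB wR wBC wRC (fun u hu => hvars hu (by simp)) hn
      (by omega) hlen ?_ (hD.mono hpR (Nat.zero_le _))
      (hD.mono (hD.not_conLit_of_not_choice wB wR wRann.2 wRA wch hn (by simpa using ha) hr
        fun u hu => hvars hu (by simp)) (by omega))
    · refine hD.mono (hD.same_right_of_not_select wH₂ (wsel u hu) (hvars hu (by simp))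
        (hset u hu).1 (hset u hu).2 (hD.not_select_of_not_choice hand wB wch ha)) (by omega)
    · exact hD.mono (hD.step [] (imp (and (var 0) (neg (var 1))) (var 0))
        [B.toForm P', Policy.choice L R τ x (QPrefix.universals Q).reverse] .nil
        (by simpa using ⟨wB, wch⟩) (by simp only [eval]; exact fun _ _ h => h.1) (by decide))
        (by simp [hk])
  refine ⟨wBcl, hD.mono (hD.step [imp (and (var 0) (var 1)) (var 2),
    imp (and (var 0) (neg (var 1))) (var 2)] (imp (var 0) (var 2))
    [B.toForm P', Policy.choice L R τ x (QPrefix.universals Q).reverse, B.con P' (C₁ ++ C₂)]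
    (.cons hleft (.cons hright .nil)) (by simp [wB, wch, wBC])
    (fun v h => by simp [eval] at h ⊢; clear * - h; tauto) (by decide)) ?_⟩
  simp only [List.sum_cons, List.sum_nil, stepBound, ← hk]
  omega

end QBFPolicy

open QBFPolicy

theorem mainTheorem5 (F : QBFPolicy.FregeSystem) :
    ∃ p : Polynomial ℕ,
      ∀ (P : QBFPolicy.QPrefix) (L R : QBFPolicy.Policy) (C₁ C₂ : QBFPolicy.AnnClause)
        (x : ℕ) (τ : QBFPolicy.Annotation),
        (QBFPolicy.QPrefix.names P).Nodup →
        L.Respects P → R.Respects P →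
        (∀ l ∈ C₁, QBFPolicy.AnnLit.WellFormed P l) →
        (∀ l ∈ C₂, QBFPolicy.AnnLit.WellFormed P l) →
        QBFPolicy.AnnLit.WellFormed P ⟨x, true, τ⟩ →
        ∃ (B : QBFPolicy.Policy) (P' : QBFPolicy.QPrefix) (π : List QBFPolicy.Form),
          QBFPolicy.EFregeDerivation F P
            [QBFPolicy.Policy.claim P L (C₁ ++ [⟨x, false, τ⟩]),
              QBFPolicy.Policy.claim P R (C₂ ++ [⟨x, true, τ⟩])] P' π ∧
          B.Respects P' ∧
          π.head? = some (QBFPolicy.Policy.claim P' B (C₁ ++ C₂)) ∧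
          QBFPolicy.derivationSize π ≤
            p.eval ((QBFPolicy.Policy.claim P L (C₁ ++ [⟨x, false, τ⟩])).size +
              (QBFPolicy.Policy.claim P R (C₂ ++ [⟨x, true, τ⟩])).size) := by
  obtain ⟨c, hc⟩ := F.exists_costDerivability
  obtain ⟨p, hp⟩ : ∃ p : Polynomial ℕ, ∀ n, p.eval n =
      n + n * (4 * choiceBound n + 16) + (stepBound n + 2) * (c * sizeBound n) := by
    -- The polynomials `b`, `k`, `t` evaluate to `choiceBound`, to the cost of the hypotheses of
    -- `con_of_same`, and to `transferCost` at this cost.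
    let N : Polynomial ℕ := .X
    let b := N * (5 * N + 8) + 5 * N + 5
    let k := N * (2 * N + 2) + N + 6
    let t := N * (N * (k + 2) + N + 4 + 2 * k + 1) + N * (k + 2) + 4 + 2 * k
    refine ⟨N + N * (4 * b + 16) + (2 * t + 1 + 2) * (.C c * (b + N + 20)), fun n => ?_⟩
    simp [N, b, k, t, choiceBound, stepBound, sizeBound, CostDerivability.transferCost]
  refine ⟨p, fun P L R C₁ C₂ x τ hP hL hR hC₁ hC₂ hx => ?_⟩
  have mem_names {l : AnnLit} (h : l.WellFormed P) : l.x ∈ P.names := List.mem_map_of_mem h.1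
  -- `Q` is the part of the prefix left of `x`.
  obtain ⟨Q, Q', hPdef⟩ : ∃ Q Q' : QPrefix, P = Q ++ (Quant.ex, x) :: Q' :=
    List.append_of_mem hx.1
  subst hPdef
  set P : QPrefix := Q ++ (Quant.ex, x) :: Q' with hPdef
  set N := (QBFPolicy.Policy.claim P L (C₁ ++ [⟨x, false, τ⟩])).size +
    (QBFPolicy.Policy.claim P R (C₂ ++ [⟨x, true, τ⟩])).size with hN
  obtain ⟨m, hm⟩ : ∃ m, ∀ v ∈ P.names, v < m := by
    obtain ⟨m, hm⟩ := Finset.exists_nat_subset_range P.names.toFinset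
    exact ⟨m, fun v hv => Finset.mem_range.1 (hm (List.mem_toFinset.2 hv))⟩
  have hxs {C : AnnClause} (hC : ∀ l ∈ C, AnnLit.WellFormed P l) (b : Bool) :
      ∀ l ∈ C ++ [(⟨x, b, τ⟩ : AnnLit)], l.x ∈ P.names := by
    simp only [List.mem_append, List.mem_singleton]
    rintro l (h | rfl)
    exacts [mem_names (hC l h), mem_names hx]
  have hlen : P.universals.length ≤ N := by
    have := L.size_toForm (P := P)
    simp only [hN, Policy.claim, Form.size]
    omega
  have hlenQ : (QPrefix.universals Q).length ≤ N := by
    refine le_trans ?_ hlen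
    rw [hPdef, QPrefix.universals_append, List.length_append]
    omega
  have d₀ := ((EFregeDerivation.nil (F := F) (P₀ := P) (Γ := [L.claim P (C₁ ++ [⟨x, false, τ⟩]),
    R.claim P (C₂ ++ [⟨x, true, τ⟩])])).hyp (by simp)
      (Policy.vars_claim hL (hxs hC₁ false))).hyp (by simp)
      (Policy.vars_claim hR (hxs hC₂ true))
  let s (A B : ℕ → ℕ) (u : ℕ) : Form :=
    Form.ite (L.select R τ x (QPrefix.universals Q) u) (.var (A u)) (.var (B u))
  obtain ⟨π₁, d₁, hdef, z₁⟩ := d₀.exists_expand hm hP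
    (s := s L.setVar R.setVar) (t := s L.valVar R.valVar) (z := 4 * choiceBound N + 16) (by
      intro u hu v hv
      have h₁ := hL u hu
      have h₂ := hR u hu
      have h₃ (h : v ∈ (L.select R τ x (QPrefix.universals Q) u).vars) : P.LeftOf v u :=
        Policy.vars_select hP hL hR hu h
      simp only [s, Form.ite, Form.vars, Finset.mem_union, Finset.mem_singleton] at hv
      rcases hv with ((h | rfl) | h | rfl) | (h | rfl) | h | rfl
      exacts [h₃ h, h₁.1, h₃ h, h₂.1, h₃ h, h₁.2, h₃ h, h₂.2]) (by
      intro u _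
      have := L.size_select_le R τ x hlenQ u
      simp only [s, Form.ite, Form.size]
      omega)
  set B := Policy.fresh m
  set P' := P.expand B
  have hM : 1 ≤ sizeBound N := by unfold sizeBound; omega
  obtain ⟨hD, hlast⟩ := hc P [L.claim P (C₁ ++ [⟨x, false, τ⟩]),
    R.claim P (C₂ ++ [⟨x, true, τ⟩])] P' (π₁ ++ [R.claim P (C₂ ++ [⟨x, true, τ⟩]),
      L.claim P (C₁ ++ [⟨x, false, τ⟩])]) (sizeBound N) hM
  obtain ⟨hw, hreach⟩ := hD.claim_resolvent hP (P' := P') (B := B) (L := L) (R := R)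
    (C₁ := C₁) (C₂ := C₂) (τ := τ) (QPrefix.universals_expand _ _) (List.Subset.refl _)
    (QPrefix.names_sublist_expand _ _).subset (QPrefix.respects_expand _ _) hL hR (by
      intro l hl
      have hl' : l.x ∈ P.names := by
        rcases List.mem_append.1 hl with h | h
        exacts [mem_names (hC₁ l h), mem_names (hC₂ l h)]
      exact ⟨hl', (QPrefix.names_sublist_expand _ _).subset hl', fun u hu =>
        QPrefix.leftOf_expand_fresh hm (QPrefix.mem_names_of_mem_universals hu) hl'⟩) hN.ge
    (reach_of_mem (List.mem_append_right _ (List.mem_cons_of_mem _ List.mem_cons_self)))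
    (reach_of_mem (List.mem_append_right _ List.mem_cons_self))
    fun u hu => ⟨reach_of_mem (List.mem_append_left _ (hdef u hu).1),
      reach_of_mem (List.mem_append_left _ (hdef u hu).2)⟩
  -- The claim may have been derived already; it is repeated to become the last line.
  obtain ⟨π₂, d₂, m₂, z₂⟩ := hreach _ (List.Subset.refl _) d₁
  obtain ⟨π₃, d₃, m₃, z₃⟩ := hlast _ _ hw m₂ d₂
  refine ⟨B, P', _, d₃, QPrefix.respects_expand _ _, m₃, ?_⟩
  have hmul := Nat.mul_le_mul_right (4 * choiceBound N + 16) hlen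
  rw [hp, derivationSize_append, derivationSize_append, derivationSize_append,
    derivationSize_cons, derivationSize_cons, add_mul (stepBound N) 2]
  have h₀ : derivationSize [] = 0 := rfl
  omega
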